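/- Let $d\ge 1$ and, for $p\in[0,1]$, construct a fractal percolation with parameter $p$ as follows: $Z_0=\{[-\frac12,\frac12)^d\}$, and, given $Z_k$, divide each cube in $Z_k$ into its $2^d$ half-open dyadic subcubes of side length $2^{-k-1}$ and keep each of them independently with probability $p$; $Z_{k+1}$ is the collection of the kept cubes. For $k\ge 1$ put $Q_d(p;k):=\big(\bigcup_{Q\in Z_k}2^kQ\big)\cap\mathbb Z^d$. For $\beta>0$ and a nonempty finite set $A\subset\mathbb Z^d$ let \[ \mathrm{Cap}_\beta(A):=\Big(\inf_\mu\sum_{x,y\in A}\mu(x)\mu(y)(|x-y|\vee 1)^{-\beta}\Big)^{-1}, \] where the infimum is over all probability measures $\mu$ on $A$ and $|\cdot|$ is the Euclidean norm, and let $\mathrm{diam}(A)$ be the Euclidean diameter of $A$ (with $\log_2 0=-\infty$). Theorem. Let $d\ge1$ and let $p,q\in(0,1)$ satisfy $p,q>2^{-d}$ and $\beta:=-\log_2(2^dpq)>0$. There are constants $c,C>0$, depending only on $d,p,q$, such that the following holds. Let $Q_d$ and $\widehat Q_d$ be independent fractal percolations with parameters $p$ and $q$. Then for all integers $1\le m\le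 n$ and every nonempty $A\subset[-2^{n-1},2^{n-1})^d\cap\mathbb Z^d$, \[ c\,(2^dp)^m\;\le\;\frac{\mathbb P\big((Q_d(p;m)+\widehat Q_d(q;n))\cap A\neq\emptyset\big)}{q^n\,\mathrm{Cap}_\beta(A)}\;\le\; C\,(2^dp)^{m\vee\log_2\mathrm{diam}(A)}, \] where $+$ between sets is the Minkowski sum. -/

import Mathlib

open MeasureTheory ProbabilityTheory
open scoped Pointwise

noncomputable section

namespace FractalPercolation

/-- A lattice point, seen as a point of Euclidean space `ℝ^d`. -/
def toEuc {d : ℕ} (x : Fin d → ℤ) : EuclideanSpace ℝ (Fin d) :=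
  WithLp.toLp 2 (fun i => (x i : ℝ))

/-- The Euclidean diameter of a finite set of lattice points. -/
def diam {d : ℕ} (A : Finset (Fin d → ℤ)) : ℝ :=
  Metric.diam (toEuc '' (A : Set (Fin d → ℤ)))

/-- The probability measures on the finite set `A`, given by their weights on the points of `A`. -/
def probWeights {d : ℕ} (A : Finset (Fin d → ℤ)) : Set ((Fin d → ℤ) → ℝ) :=
  {w | (∀ x ∈ A, 0 ≤ w x) ∧ ∑ x ∈ A, w x = 1}

/-- The energy `∑_{x,y ∈ A} w(x) w(y) (|x-y| ∨ 1)^{-β}`, with `|x-y|` the Euclidean distance. -/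
def energy {d : ℕ} (β : ℝ) (A : Finset (Fin d → ℤ)) (w : (Fin d → ℤ) → ℝ) : ℝ :=
  ∑ x ∈ A, ∑ y ∈ A, w x * w y * (max (dist (toEuc x) (toEuc y)) 1) ^ (-β)

/-- The discrete Newtonian capacity `Cap_β(A)`. -/
def cap {d : ℕ} (β : ℝ) (A : Finset (Fin d → ℤ)) : ℝ :=
  (sInf (energy β A '' probWeights A))⁻¹

/-- The starting cube `[-1/2, 1/2)^d`. -/
def unitCube (d : ℕ) : Set (Fin d → ℝ) :=
  {x | ∀ i, -(1 / 2) ≤ x i ∧ x i < 1 / 2}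

/-- The half-open dyadic cube `2^{-k} (v + [0,1)^d)` of side length `2^{-k}`. -/
def dyadicCube {d : ℕ} (k : ℕ) (v : Fin d → ℤ) : Set (Fin d → ℝ) :=
  {x | ∀ i, (v i : ℝ) / 2 ^ k ≤ x i ∧ x i < ((v i : ℝ) + 1) / 2 ^ k}

/-- Independent Bernoulli(`p`) coins, one for each dyadic cube `dyadicCube k v`;
`ξ (k, v) ω = true` means that this cube is kept when it is examined. -/
structure IsCoinField {d : ℕ} {Ω : Type*} [MeasurableSpace Ω] (p : ℝ) (P : Measure Ω)
    (ξ : ℕ × (Fin d → ℤ) → Ω → Bool) : Prop where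
  measurable : ∀ c, Measurable (ξ c)
  indep : iIndepFun ξ P
  prob : ∀ c, P {ω | ξ c ω = true} = ENNReal.ofReal p

/-- The collection `Z_k` of cubes retained at step `k`: start from the single cube
`[-1/2, 1/2)^d`; at step `k + 1`, divide each cube in `Z_k` into the dyadic cubes of side length
`2^{-(k+1)}` contained in it, and keep those whose coin is `true`. -/
def retained {d : ℕ} {Ω : Type*} (ξ : ℕ × (Fin d → ℤ) → Ω → Bool) (ω : Ω) :
    ℕ → Set (Set (Fin d → ℝ))
  | 0 => {unitCube d}
  | k + 1 => {C | ∃ D ∈ retained ξ ω k, ∃ v : Fin d → ℤ,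
      C = dyadicCube (k + 1) v ∧ C ⊆ D ∧ ξ (k + 1, v) ω = true}

/-- The discrete fractal percolation `(⋃_{C ∈ Z_k} 2^k C) ∩ ℤ^d`. -/
def discretePerc {d : ℕ} {Ω : Type*} (ξ : ℕ × (Fin d → ℤ) → Ω → Bool) (k : ℕ) (ω : Ω) :
    Set (Fin d → ℤ) :=
  {x | (fun i => (x i : ℝ)) ∈ ⋃ C ∈ retained ξ ω k, (2 : ℝ) ^ k • C}

end FractalPercolation

end

/-! The event means that some pair `z = (x, y)` with `x + y ∈ A` has all the coins on its two
ancestral lines successful. For such an event the natural kernel is `hitKernel`, the reciprocal of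
the product of the success probabilities of the shared coins. Up to a constant the hitting
probability is the reciprocal of the least energy for this kernel.

One direction is the second moment method (`one_le_hitProb_mul_hitEnergy`), which applies to every
weight of total mass one. For the other (`exists_hitProb_mul_hitEnergy_le`), let `ν` be the law of a
chosen hitting pair, conditioned on a hit. Order each tree in a planar way. Conditioning on the
coins that precede a hitting pair `z` in both orders, the expected mass of the normalised random
measure is at least the potential of `ν` at `z` restricted to the quadrant after `z`. Cairoli's
two-parameter maximal inequality bounds the second moment of this potential by the energy. Summing
over the four quadrants bounds hitting probability times energy by 256.

It remains to compare energies. After multiplication by `p ^ m * q ^ n` the kernel is `p ^ h * q ^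
h'`, where `h` and `h'` are the heights of the smallest common cubes. Put `t = 2 ^ d * p * q = 2 ^
(-β)`, so that `t ^ lev (a - b)` is comparable to the Newtonian kernel.

Lower bound: each atom `a` is spread uniformly over about `2 ^ (d * m)` pairs `(x, a - x)`; the sum
of `p ^ lev z * q ^ lev (δ - z)` over `z` is at most a constant times `t ^ lev δ`
(`exists_sum_pow_lev_mul_le`).

Upper bound: `ν` is pushed forward under addition, and the energies are compared scale by scale,
with Cauchy–Schwarz and a count of the pairs of cubes whose sum can meet a given cube
(`sum_pow_lev_le_hitEnergy`). The scales between `m` and the logarithm of the diameter produce the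
exponent of the upper bound. -/

noncomputable section

namespace FractalPercolation

/-! ### Finite families of independent coins, conditioning, and maximal inequalities. -/

section CoinModel

variable {N : Type*} [DecidableEq N]

/-- The probability that `T` is the set of successful coins among the independent coins in `S`,
where the coin `c` succeeds with probability `p c`. -/
def coinWeight (p : N → ℝ) (S T : Finset N) : ℝ :=
  (∏ c ∈ T, p c) * ∏ c ∈ S \ T, (1 - p c)

/-- The expectation of `f`, evaluated at the random set of successful coins. -/
def coinMean (p : N → ℝ) (S : Finset N) (f : Finset N → ℝ) : ℝ :=
  ∑ T ∈ S.powerset, coinWeight p S T * f T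

/-- The configuration that agrees with `T` on `A` and with `T'` off `A`. -/
def mix (A T T' : Finset N) : Finset N := (T ∩ A) ∪ (T' \ A)

/-- The conditional expectation of `f` given the coins in `A`. -/
def coinCond (p : N → ℝ) (S A : Finset N) (f : Finset N → ℝ) (T : Finset N) : ℝ :=
  coinMean p S (fun T' => f (mix A T T'))

lemma mem_mix {A T T' : Finset N} {c : N} :
    c ∈ mix A T T' ↔ (c ∈ A ∧ c ∈ T) ∨ (c ∉ A ∧ c ∈ T') := by
  simp [mix]; tauto

lemma mix_subset {S A T T' : Finset N} (h : T ⊆ S) (h' : T' ⊆ S) : mix A T T' ⊆ S := by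
  intro c hc
  rcases mem_mix.1 hc with ⟨_, h1⟩ | ⟨_, h1⟩
  exacts [h h1, h' h1]

lemma coinWeight_eq_prod (p : N → ℝ) {S T : Finset N} (h : T ⊆ S) :
    coinWeight p S T = ∏ c ∈ S, if c ∈ T then p c else 1 - p c := by
  rw [Finset.prod_ite, coinWeight]
  congr 2
  · ext c; simp; exact fun hc => h hc
  · ext c; simp

lemma coinWeight_nonneg {p : N → ℝ} (h0 : ∀ c, 0 ≤ p c) (h1 : ∀ c, p c ≤ 1) (S T : Finset N) :
    0 ≤ coinWeight p S T :=
  mul_nonneg (Finset.prod_nonneg fun c _ => h0 c)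
    (Finset.prod_nonneg fun c _ => sub_nonneg.2 (h1 c))

lemma coinWeight_mix (p : N → ℝ) {S : Finset N} (A : Finset N) {T T' : Finset N}
    (h : T ⊆ S) (h' : T' ⊆ S) :
    coinWeight p S (mix A T T') * coinWeight p S (mix A T' T)
      = coinWeight p S T * coinWeight p S T' := by
  rw [coinWeight_eq_prod p h, coinWeight_eq_prod p h', coinWeight_eq_prod p (mix_subset h h'),
    coinWeight_eq_prod p (mix_subset h' h), ← Finset.prod_mul_distrib, ← Finset.prod_mul_distrib]
  refine Finset.prod_congr rfl fun c _ => ?_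
  by_cases hA : c ∈ A <;> simp [mem_mix, hA, mul_comm]

lemma mix_mix (A T T' : Finset N) : mix A (mix A T T') (mix A T' T) = T := by
  ext c; simp only [mem_mix]; tauto

/-- The mean is the expansion of a product of binomials `p c + (1 - p c)` in which the failure term
is deleted for `c ∈ B`. -/
lemma coinMean_superset (p : N → ℝ) {S B : Finset N} (h : B ⊆ S) :
    coinMean p S (fun T => if B ⊆ T then 1 else 0) = ∏ c ∈ B, p c := by
  have h1 : ∀ T ∈ S.powerset, coinWeight p S T * (if B ⊆ T then 1 else 0)
      = (∏ c ∈ T, p c) * ∏ c ∈ S \ T, (if c ∈ B then 0 else 1 - p c) := by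
    intro T hT
    split_ifs with hB
    · rw [mul_one, coinWeight]
      congr 1
      refine Finset.prod_congr rfl fun c hc => ?_
      rw [if_neg]
      exact fun hcB => (Finset.mem_sdiff.1 hc).2 (hB hcB)
    · obtain ⟨c, hcB, hcT⟩ := Finset.not_subset.1 hB
      rw [mul_zero, Finset.prod_eq_zero (i := c) (s := S \ T)]
      · simp
      · exact Finset.mem_sdiff.2 ⟨h hcB, hcT⟩
      · simp [hcB]
  rw [coinMean, Finset.sum_congr rfl h1, ← Finset.prod_add]
  rw [← Finset.prod_subset h (f := fun c => p c + if c ∈ B then 0 else 1 - p c)]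
  · exact Finset.prod_congr rfl fun c hc => by simp [hc]
  · intro c _ hc; simp [hc]

lemma coinMean_const (p : N → ℝ) (S : Finset N) (a : ℝ) : coinMean p S (fun _ => a) = a := by
  have := coinMean_superset p (Finset.empty_subset S)
  simp only [Finset.empty_subset, if_true, Finset.prod_empty, coinMean, mul_one] at this
  rw [coinMean, ← Finset.sum_mul, this, one_mul]

lemma coinMean_mono {p : N → ℝ} (h0 : ∀ c, 0 ≤ p c) (h1 : ∀ c, p c ≤ 1) {S : Finset N}
    {f g : Finset N → ℝ} (h : ∀ T, f T ≤ g T) : coinMean p S f ≤ coinMean p S g :=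
  Finset.sum_le_sum fun T _ => mul_le_mul_of_nonneg_left (h T) (coinWeight_nonneg h0 h1 S T)

lemma coinMean_add (p : N → ℝ) (S : Finset N) (f g : Finset N → ℝ) :
    coinMean p S (fun T => f T + g T) = coinMean p S f + coinMean p S g := by
  simp [coinMean, mul_add, Finset.sum_add_distrib]

lemma coinMean_mul_left (p : N → ℝ) (S : Finset N) (a : ℝ) (f : Finset N → ℝ) :
    coinMean p S (fun T => a * f T) = a * coinMean p S f := by
  simp only [coinMean, Finset.mul_sum]
  exact Finset.sum_congr rfl fun T _ => by ring

lemma coinMean_sub (p : N → ℝ) (S : Finset N) (f g : Finset N → ℝ) :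
    coinMean p S (fun T => f T - g T) = coinMean p S f - coinMean p S g := by
  simp [coinMean, mul_sub, Finset.sum_sub_distrib]

lemma coinMean_sum {ι : Type*} (p : N → ℝ) (S : Finset N) (s : Finset ι)
    (f : ι → Finset N → ℝ) :
    coinMean p S (fun T => ∑ i ∈ s, f i T) = ∑ i ∈ s, coinMean p S (f i) := by
  simp only [coinMean, Finset.mul_sum]
  exact Finset.sum_comm

/-- Resampling the coins off `A` does not change the law: exchanging those coins between two
independent configurations is an involution that preserves the product weight. -/
lemma coinMean_coinMean_mix (p : N → ℝ) (S A : Finset N) (g : Finset N → ℝ) :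
    coinMean p S (fun T => coinMean p S (fun T' => g (mix A T T'))) = coinMean p S g := by
  have e1 : coinMean p S (fun T => coinMean p S (fun T' => g (mix A T T')))
      = ∑ x ∈ S.powerset ×ˢ S.powerset,
        coinWeight p S x.1 * coinWeight p S x.2 * g (mix A x.1 x.2) := by
    simp only [coinMean, Finset.mul_sum, Finset.sum_product, mul_assoc]
  have e2 : coinMean p S g = ∑ x ∈ S.powerset ×ˢ S.powerset,
        coinWeight p S x.1 * coinWeight p S x.2 * g x.1 := by
    have := coinMean_const p S 1
    simp only [coinMean, mul_one] at this
    rw [Finset.sum_product]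
    refine Finset.sum_congr rfl fun T _ => ?_
    simp only [mul_right_comm _ _ (g _)]
    rw [← Finset.mul_sum, this, mul_one]
  rw [e1, e2]
  refine Finset.sum_nbij' (fun x => (mix A x.1 x.2, mix A x.2 x.1))
    (fun x => (mix A x.1 x.2, mix A x.2 x.1)) ?_ ?_ ?_ ?_ ?_
  · intro x hx
    simp only [Finset.mem_product, Finset.mem_powerset] at hx ⊢
    exact ⟨mix_subset hx.1 hx.2, mix_subset hx.2 hx.1⟩
  · intro x hx
    simp only [Finset.mem_product, Finset.mem_powerset] at hx ⊢
    exact ⟨mix_subset hx.1 hx.2, mix_subset hx.2 hx.1⟩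
  · intro x _; simp [mix_mix]
  · intro x _; simp [mix_mix]
  · intro x hx
    simp only [Finset.mem_product, Finset.mem_powerset] at hx ⊢
    rw [coinWeight_mix p A hx.1 hx.2]

lemma coinMean_coinCond (p : N → ℝ) (S A : Finset N) (f : Finset N → ℝ) :
    coinMean p S (coinCond p S A f) = coinMean p S f :=
  coinMean_coinMean_mix p S A f

/-- Independence makes conditional expectations commute, so that a two-parameter martingale is an
iterated one-parameter martingale; Cairoli's inequality rests on this. -/
lemma coinCond_coinCond (p : N → ℝ) (S A B : Finset N) (f : Finset N → ℝ) :
    coinCond p S A (coinCond p S B f) = coinCond p S (A ∩ B) f := by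
  funext T
  change coinMean p S (fun T' => coinMean p S (fun T'' => f (mix B (mix A T T') T'')))
    = coinMean p S (fun T' => f (mix (A ∩ B) T T'))
  rw [← coinMean_coinMean_mix p S B (fun T' => f (mix (A ∩ B) T T'))]
  refine congrArg (coinMean p S) (funext fun T' =>
    congrArg (coinMean p S) (funext fun T'' => congrArg f ?_))
  ext c; simp only [mem_mix, Finset.mem_inter]; tauto

lemma coinCond_mono {p : N → ℝ} (h0 : ∀ c, 0 ≤ p c) (h1 : ∀ c, p c ≤ 1) {S A : Finset N}
    {f g : Finset N → ℝ} (h : ∀ T, f T ≤ g T) (T : Finset N) :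
    coinCond p S A f T ≤ coinCond p S A g T :=
  coinMean_mono h0 h1 fun _ => h _

lemma coinCond_nonneg {p : N → ℝ} (h0 : ∀ c, 0 ≤ p c) (h1 : ∀ c, p c ≤ 1) {S A : Finset N}
    {f : Finset N → ℝ} (h : ∀ T, 0 ≤ f T) (T : Finset N) : 0 ≤ coinCond p S A f T :=
  Finset.sum_nonneg fun T' _ => mul_nonneg (coinWeight_nonneg h0 h1 S T') (h _)

/-- A conditional expectation given `A` depends only on the coins in `B ⊇ A`. -/
lemma coinCond_mix (p : N → ℝ) (S : Finset N) {A B : Finset N} (h : A ⊆ B) (f : Finset N → ℝ)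
    (T T' : Finset N) : coinCond p S A f (mix B T T') = coinCond p S A f T := by
  refine congrArg (coinMean p S) (funext fun T'' => congrArg f ?_)
  ext c
  have := @h c
  simp only [mem_mix]; tauto

/-- A factor that depends only on the coins in `A` may be conditioned through. -/
lemma coinMean_mul_coinCond (p : N → ℝ) (S A : Finset N) {g : Finset N → ℝ}
    (hg : ∀ T T', g (mix A T T') = g T) (f : Finset N → ℝ) :
    coinMean p S (fun T => g T * coinCond p S A f T) = coinMean p S (fun T => g T * f T) := by
  rw [← coinMean_coinCond p S A (fun T => g T * f T)]
  refine congrArg _ (funext fun T => ?_)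
  simp only [coinCond, hg, coinMean_mul_left]

/-- The running maximum of a sequence. -/
def runMax (x : ℕ → ℝ) : ℕ → ℝ
  | 0 => x 0
  | k + 1 => max (runMax x k) (x (k + 1))

lemma le_runMax (x : ℕ → ℝ) {i k : ℕ} (h : i ≤ k) : x i ≤ runMax x k := by
  induction k with
  | zero => rw [Nat.le_zero.1 h]; rfl
  | succ k ih =>
    rcases h.eq_or_lt with rfl | h
    · exact le_max_right _ _
    · exact (ih (Nat.lt_succ_iff.1 h)).trans (le_max_left _ _)

lemma runMax_le {x : ℕ → ℝ} {k : ℕ} {a : ℝ} (h : ∀ i ≤ k, x i ≤ a) : runMax x k ≤ a := by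
  induction k with
  | zero => exact h 0 le_rfl
  | succ k ih => exact max_le (ih fun i hi => h i (hi.trans k.le_succ)) (h _ le_rfl)

lemma runMax_congr {x y : ℕ → ℝ} {k : ℕ} (h : ∀ i ≤ k, x i = y i) : runMax x k = runMax y k :=
  le_antisymm (runMax_le fun i hi => (h i hi).trans_le (le_runMax y hi))
    (runMax_le fun i hi => (h i hi).symm.trans_le (le_runMax x hi))

/-- The trajectorial form of Doob's `L²` inequality. -/
lemma sum_runMax_mul_sub_le (x : ℕ → ℝ) (n : ℕ) :
    ∑ k ∈ Finset.range n, runMax x k * (x (k + 1) - x k)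
      ≤ runMax x n * x n - runMax x n ^ 2 / 2 := by
  induction n with
  | zero => simp [runMax]; nlinarith [sq_nonneg (x 0)]
  | succ n ih =>
    rw [Finset.sum_range_succ]
    change _ ≤ max (runMax x n) (x (n + 1)) * x (n + 1) - max (runMax x n) (x (n + 1)) ^ 2 / 2
    rcases le_total (runMax x n) (x (n + 1)) with h | h
    · rw [max_eq_right h]; nlinarith [sq_nonneg (x (n + 1) - runMax x n)]
    · rw [max_eq_left h]; linarith

/-- Doob's `L²` maximal inequality for the conditional expectations along an increasing sequence
of sets of coins. -/
lemma doob_sq {p : N → ℝ} (h0 : ∀ c, 0 ≤ p c) (h1 : ∀ c, p c ≤ 1) (S : Finset N)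
    {A : ℕ → Finset N} (hA : Monotone A) (f : Finset N → ℝ) (n : ℕ) :
    coinMean p S (fun T => runMax (fun k => coinCond p S (A k) f T) n ^ 2)
      ≤ 4 * coinMean p S (fun T => f T ^ 2) := by
  set X : Finset N → ℕ → ℝ := fun T k => coinCond p S (A k) f T with hX
  have hmeas : ∀ k T T', runMax (X (mix (A k) T T')) k = runMax (X T) k := fun k T T' =>
    runMax_congr fun i hi => coinCond_mix p S (hA hi) f T T'
  have hmart : ∀ k, coinMean p S (fun T => runMax (X T) k * (X T (k + 1) - X T k)) = 0 := by
    intro k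
    have e := coinMean_mul_coinCond p S (A k) (g := fun T => runMax (X T) k) (hmeas k)
      (coinCond p S (A (k + 1)) f)
    rw [coinCond_coinCond, Finset.inter_eq_left.2 (hA k.le_succ)] at e
    simp only [mul_sub, coinMean_sub]
    rw [sub_eq_zero]
    exact e.symm
  have key : coinMean p S (fun T => ∑ k ∈ Finset.range n, runMax (X T) k * (X T (k + 1) - X T k))
      ≤ coinMean p S (fun T => runMax (X T) n * X T n - runMax (X T) n ^ 2 / 2) :=
    coinMean_mono h0 h1 fun T => sum_runMax_mul_sub_le (X T) n
  rw [coinMean_sum, Finset.sum_eq_zero fun k _ => hmart k, coinMean_sub,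
    coinMean_mul_coinCond p S (A n) (g := fun T => runMax (X T) n) (hmeas n) f] at key
  -- The weight 1/4 lets half of the term `runMax ^ 2 / 2` in `key` absorb the maximum, which leaves
  -- the constant 4.
  have h2 : coinMean p S (fun T => runMax (X T) n * f T)
      ≤ coinMean p S (fun T => (1 / 4) * runMax (X T) n ^ 2 + f T ^ 2) :=
    coinMean_mono h0 h1 fun T => by nlinarith [sq_nonneg (runMax (X T) n / 2 - f T)]
  rw [coinMean_add, coinMean_mul_left] at h2
  have h3 : coinMean p S (fun T => runMax (X T) n ^ 2 / 2)
      = (1 / 2) * coinMean p S (fun T => runMax (X T) n ^ 2) := by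
    rw [← coinMean_mul_left]; exact congrArg _ (funext fun T => by ring)
  linarith

/-- Cairoli's maximal inequality: the two-parameter version of Doob's inequality, for two
increasing sequences of sets in two independent families of coins. -/
lemma cairoli_sq {p : N → ℝ} (h0 : ∀ c, 0 ≤ p c) (h1 : ∀ c, p c ≤ 1) (S : Finset N)
    {A B : ℕ → Finset N} (hA : Monotone A) (hB : Monotone B) {f : Finset N → ℝ}
    (hf : ∀ T, 0 ≤ f T) (n : ℕ) {g : Finset N → ℝ} (hg0 : ∀ T, 0 ≤ g T)
    (hg : ∀ T, g T ≠ 0 → ∃ k ≤ n, ∃ l ≤ n, g T ≤ coinCond p S (A k ∩ B l) f T) :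
    coinMean p S (fun T => g T ^ 2) ≤ 16 * coinMean p S (fun T => f T ^ 2) := by
  set G : Finset N → ℝ := fun T => runMax (fun l => coinCond p S (B l) f T) n with hG
  set H : Finset N → ℝ := fun T => runMax (fun k => coinCond p S (A k) G T) n with hH
  have hG0 : ∀ T, 0 ≤ G T := fun T =>
    (coinCond_nonneg h0 h1 hf T).trans (le_runMax (fun l => coinCond p S (B l) f T) n.zero_le)
  have hle : ∀ T, g T ≤ H T := by
    intro T
    by_cases hT : g T = 0
    · rw [hT]
      exact (coinCond_nonneg h0 h1 hG0 T).trans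
        (le_runMax (fun k => coinCond p S (A k) G T) n.zero_le)
    · obtain ⟨k, hk, l, hl, h⟩ := hg T hT
      refine h.trans (le_trans ?_ (le_runMax (fun k => coinCond p S (A k) G T) hk))
      rw [← coinCond_coinCond]
      exact coinCond_mono h0 h1 (fun T' => le_runMax (fun l => coinCond p S (B l) f T') hl) T
  have e1 : coinMean p S (fun T => g T ^ 2) ≤ coinMean p S (fun T => H T ^ 2) :=
    coinMean_mono h0 h1 fun T => pow_le_pow_left₀ (hg0 T) (hle T) 2
  have e2 := doob_sq h0 h1 S hA G n
  have e3 := doob_sq h0 h1 S hB f n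
  linarith

end CoinModel

/-! ### Hitting probability against energy, for general families of paths. -/

section Hitting

variable {N Z : Type*} [DecidableEq N]

open Classical in
/-- The probability that all coins on the path of some `z ∈ E` succeed. -/
def hitProb (p : N → ℝ) (S : Finset N) (path : Z → Finset N) (E : Finset Z) : ℝ :=
  coinMean p S (fun T => if ∃ z ∈ E, path z ⊆ T then 1 else 0)

/-- The correlation of the events that the paths of `z` and of `z'` succeed. -/
def hitKernel (p : N → ℝ) (path : Z → Finset N) (z z' : Z) : ℝ :=
  (∏ c ∈ path z ∩ path z', p c)⁻¹

/-- The energy of `ν` for the correlation kernel. -/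
def hitEnergy (p : N → ℝ) (path : Z → Finset N) (E : Finset Z) (ν : Z → ℝ) : ℝ :=
  ∑ z ∈ E, ∑ z' ∈ E, ν z * ν z' * hitKernel p path z z'

/-- The indicator that the path of `z` succeeds, normalised to have mean one. -/
def hitDensity (p : N → ℝ) (path : Z → Finset N) (z : Z) (T : Finset N) : ℝ :=
  if path z ⊆ T then (∏ c ∈ path z, p c)⁻¹ else 0

/-- The total mass of the random measure with density `hitDensity` with respect to `ν`. -/
def hitMass (p : N → ℝ) (path : Z → Finset N) (E : Finset Z) (ν : Z → ℝ) (T : Finset N) : ℝ :=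
  ∑ z ∈ E, ν z * hitDensity p path z T

lemma hitKernel_pos {p : N → ℝ} (h0 : ∀ c, 0 < p c) (path : Z → Finset N) (z z' : Z) :
    0 < hitKernel p path z z' :=
  inv_pos.2 (Finset.prod_pos fun c _ => h0 c)

/-- Once the path coins inside `A` have succeeded, only those outside `A` remain random, and their
success probability cancels its share of the normalisation. -/
lemma coinCond_hitDensity {p : N → ℝ} (h0 : ∀ c, 0 < p c) {S : Finset N} {path : Z → Finset N}
    {z : Z} (hz : path z ⊆ S) {A T : Finset N} (hT : path z ∩ A ⊆ T) :
    coinCond p S A (hitDensity p path z) T = (∏ c ∈ path z ∩ A, p c)⁻¹ := by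
  have h1 : ∀ T', hitDensity p path z (mix A T T')
      = (∏ c ∈ path z, p c)⁻¹ * if path z \ A ⊆ T' then 1 else 0 := by
    intro T'
    have : path z ⊆ mix A T T' ↔ path z \ A ⊆ T' := by
      constructor
      · intro h c hc
        rw [Finset.mem_sdiff] at hc
        have := mem_mix.1 (h hc.1)
        tauto
      · intro h c hc
        rw [mem_mix]
        by_cases hA : c ∈ A
        · exact Or.inl ⟨hA, hT (Finset.mem_inter.2 ⟨hc, hA⟩)⟩
        · exact Or.inr ⟨hA, h (Finset.mem_sdiff.2 ⟨hc, hA⟩)⟩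
    simp only [hitDensity, this, mul_ite, mul_one, mul_zero]
  rw [coinCond, funext h1, coinMean_mul_left,
    coinMean_superset p (Finset.sdiff_subset.trans hz),
    ← Finset.prod_inter_mul_prod_sdiff (path z) A p]
  have := (Finset.prod_pos (s := path z ∩ A) fun c _ => h0 c).ne'
  have := (Finset.prod_pos (s := path z \ A) fun c _ => h0 c).ne'
  field_simp

lemma coinMean_hitDensity {p : N → ℝ} (h0 : ∀ c, 0 < p c) {S : Finset N} {path : Z → Finset N}
    {z : Z} (hz : path z ⊆ S) : coinMean p S (hitDensity p path z) = 1 := by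
  rw [← coinMean_coinCond p S ∅]
  have : coinCond p S ∅ (hitDensity p path z) = fun _ => 1 := by
    funext T
    rw [coinCond_hitDensity h0 hz] <;> simp
  rw [this, coinMean_const]

lemma coinMean_hitDensity_mul {p : N → ℝ} (h0 : ∀ c, 0 < p c) {S : Finset N}
    {path : Z → Finset N} {z z' : Z} (hz : path z ⊆ S) (hz' : path z' ⊆ S) :
    coinMean p S (fun T => hitDensity p path z T * hitDensity p path z' T)
      = hitKernel p path z z' := by
  have h1 : ∀ T, hitDensity p path z T * hitDensity p path z' T
      = ((∏ c ∈ path z, p c)⁻¹ * (∏ c ∈ path z', p c)⁻¹)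
        * if path z ∪ path z' ⊆ T then 1 else 0 := by
    intro T
    simp only [hitDensity, Finset.union_subset_iff]
    by_cases h : path z ⊆ T <;> by_cases h' : path z' ⊆ T <;> simp [h, h']
  rw [funext h1, coinMean_mul_left, coinMean_superset p (Finset.union_subset hz hz'), hitKernel]
  have e := Finset.prod_union_inter (s₁ := path z) (s₂ := path z') (f := p)
  have e1 := (Finset.prod_pos (s := path z) fun c _ => h0 c).ne'
  have e2 := (Finset.prod_pos (s := path z') fun c _ => h0 c).ne'
  have e3 := (Finset.prod_pos (s := path z ∩ path z') fun c _ => h0 c).ne'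
  rw [← mul_inv, ← e]
  have e4 := (Finset.prod_pos (s := path z ∪ path z') fun c _ => h0 c).ne'
  field_simp

lemma coinMean_hitMass {p : N → ℝ} (h0 : ∀ c, 0 < p c) {S : Finset N} {path : Z → Finset N}
    {E : Finset Z} (hE : ∀ z ∈ E, path z ⊆ S) (ν : Z → ℝ) :
    coinMean p S (hitMass p path E ν) = ∑ z ∈ E, ν z := by
  change coinMean p S (fun T => ∑ z ∈ E, ν z * hitDensity p path z T) = _
  rw [coinMean_sum]
  refine Finset.sum_congr rfl fun z hz => ?_
  rw [coinMean_mul_left, coinMean_hitDensity h0 (hE z hz), mul_one]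

lemma coinMean_hitMass_sq {p : N → ℝ} (h0 : ∀ c, 0 < p c) {S : Finset N} {path : Z → Finset N}
    {E : Finset Z} (hE : ∀ z ∈ E, path z ⊆ S) (ν : Z → ℝ) :
    coinMean p S (fun T => hitMass p path E ν T ^ 2) = hitEnergy p path E ν := by
  have h1 : ∀ T, hitMass p path E ν T ^ 2 = ∑ z ∈ E, ∑ z' ∈ E,
      (ν z * ν z') * (hitDensity p path z T * hitDensity p path z' T) := by
    intro T
    rw [sq, hitMass, Finset.sum_mul_sum]
    exact Finset.sum_congr rfl fun z _ => Finset.sum_congr rfl fun z' _ => by ring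
  rw [funext h1, coinMean_sum]
  refine Finset.sum_congr rfl fun z hz => ?_
  rw [coinMean_sum]
  refine Finset.sum_congr rfl fun z' hz' => ?_
  rw [coinMean_mul_left, coinMean_hitDensity_mul h0 (hE z hz) (hE z' hz')]

/-- The second moment bound. -/
lemma one_le_hitProb_mul_hitEnergy {p : N → ℝ} (h0 : ∀ c, 0 < p c) (h1 : ∀ c, p c ≤ 1)
    {S : Finset N} {path : Z → Finset N} {E : Finset Z} (hE : ∀ z ∈ E, path z ⊆ S)
    {ν : Z → ℝ} (hν : ∑ z ∈ E, ν z = 1) :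
    1 ≤ hitProb p S path E * hitEnergy p path E ν := by
  classical
  set M := hitMass p path E ν with hM
  set h : Finset N → ℝ := fun T => if ∃ z ∈ E, path z ⊆ T then 1 else 0 with hh
  have hhM : ∀ T, h T * M T = M T := by
    intro T
    by_cases hT : ∃ z ∈ E, path z ⊆ T
    · simp [hh, hT]
    · have : M T = 0 := Finset.sum_eq_zero fun z hz => by
        rw [hitDensity, if_neg fun hs => hT ⟨z, hz, hs⟩, mul_zero]
      rw [this, mul_zero]
  have hP : hitProb p S path E = coinMean p S h := by simp only [hitProb, hh]
  -- Cauchy–Schwarz in quadratic form: the second moment of `h - t * M` is nonnegative, where the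
  -- hit indicator satisfies `h * M = M`.
  have key : ∀ t : ℝ, 0 ≤ hitProb p S path E - 2 * t + t ^ 2 * hitEnergy p path E ν := by
    intro t
    have e : ∀ T, (h T - t * M T) ^ 2 = h T - 2 * t * M T + t ^ 2 * M T ^ 2 := by
      intro T
      have : h T ^ 2 = h T := by simp only [hh]; split_ifs <;> norm_num
      linear_combination this - 2 * t * hhM T
    have e2 : (0 : ℝ) ≤ coinMean p S (fun T => (h T - t * M T) ^ 2) :=
      Finset.sum_nonneg fun T _ =>
        mul_nonneg (coinWeight_nonneg (fun c => (h0 c).le) h1 S T) (sq_nonneg _)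
    rw [funext e, coinMean_add, coinMean_sub, coinMean_mul_left, coinMean_mul_left,
      coinMean_hitMass_sq h0 hE, coinMean_hitMass h0 hE, hν, mul_one] at e2
    rw [hP]; exact e2
  have hP0 : 0 ≤ hitProb p S path E := by simpa using key 0
  -- Nonpositive energy would make the quadratic negative at `t = π + 1`, with `π` the hitting
  -- probability. Otherwise its minimiser, the reciprocal of the energy, is used.
  rcases le_or_gt (hitEnergy p path E ν) 0 with hE0 | hE0
  · have := key (hitProb p S path E + 1)
    nlinarith [sq_nonneg (hitProb p S path E + 1)]
  · have := key (hitEnergy p path E ν)⁻¹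
    have e : (hitEnergy p path E ν)⁻¹ * hitEnergy p path E ν = 1 := inv_mul_cancel₀ hE0.ne'
    have e2 : hitEnergy p path E ν * (hitProb p S path E - 2 * (hitEnergy p path E ν)⁻¹
      + (hitEnergy p path E ν)⁻¹ ^ 2 * hitEnergy p path E ν)
      = hitProb p S path E * hitEnergy p path E ν - 1 := by
      linear_combination ((hitEnergy p path E ν)⁻¹ * hitEnergy p path E ν - 1) * e
    have := mul_nonneg hE0.le this
    linarith

/-- The paths are ordered by the rank `r` as in a planar tree. -/
def IsPlanarRank (E : Finset Z) (path : Z → Finset N) (r : Z → ℕ) : Prop :=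
  ∀ w ∈ E, ∀ z ∈ E, ∀ z' ∈ E, r w ≤ r z → r z ≤ r z' → path w ∩ path z' ⊆ path z

lemma IsPlanarRank.reverse {E : Finset Z} {path : Z → Finset N} {r : Z → ℕ}
    (h : IsPlanarRank E path r) {R : ℕ} (hR : ∀ z ∈ E, r z ≤ R) :
    IsPlanarRank E path (fun z => R - r z) := by
  intro w hw z hz z' hz' h1 h2
  rw [Finset.inter_comm]
  have := hR w hw; have := hR z hz; have := hR z' hz'
  exact h z' hz' z hz w hw (by simp only at h2; omega) (by simp only at h1; omega)

/-- The potential of `ν` at `z` restricted to one quadrant. -/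
def quadrantPotential (p : N → ℝ) (path : Z → Finset N) (E : Finset Z) (ν : Z → ℝ)
    (r s : Z → ℕ) (z : Z) : ℝ :=
  ∑ z' ∈ E, if r z ≤ r z' ∧ s z ≤ s z' then ν z' * hitKernel p path z z' else 0

lemma quadrantPotential_nonneg {p : N → ℝ} (h0 : ∀ c, 0 < p c) {path : Z → Finset N}
    {E : Finset Z} {ν : Z → ℝ} (hν : ∀ z, 0 ≤ ν z) (r s : Z → ℕ) (z : Z) :
    0 ≤ quadrantPotential p path E ν r s z := by
  refine Finset.sum_nonneg fun z' _ => ?_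
  split_ifs
  exacts [mul_nonneg (hν z') (hitKernel_pos h0 path z z').le, le_rfl]

-- The selected point `σ T` need not be adapted to any filtration, since Cairoli's inequality
-- controls the supremum over all pairs of times. On a hit, the martingale of the mass at time `(r
-- (σ T), s (σ T))` dominates the quadrant potential at `σ T`.
open Classical in
lemma coinMean_quadrantPotential_sq_le {p : N → ℝ} (h0 : ∀ c, 0 < p c) (h1 : ∀ c, p c ≤ 1)
    {S₁ S₂ : Finset N} (hS : Disjoint S₁ S₂) {E : Finset Z} {path path₁ path₂ : Z → Finset N}
    (hp : ∀ z, path z = path₁ z ∪ path₂ z) (hp₁ : ∀ z ∈ E, path₁ z ⊆ S₁)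
    (hp₂ : ∀ z ∈ E, path₂ z ⊆ S₂) {r s : Z → ℕ} (hr : IsPlanarRank E path₁ r)
    (hs : IsPlanarRank E path₂ s) {R : ℕ} (hrR : ∀ z ∈ E, r z ≤ R) (hsR : ∀ z ∈ E, s z ≤ R)
    {ν : Z → ℝ} (hν : ∀ z, 0 ≤ ν z) {σ : Finset N → Z}
    (hσ : ∀ T, (∃ z ∈ E, path z ⊆ T) → σ T ∈ E ∧ path (σ T) ⊆ T) :
    coinMean p (S₁ ∪ S₂) (fun T => if ∃ z ∈ E, path z ⊆ T then
        quadrantPotential p path E ν r s (σ T) ^ 2 else 0)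
      ≤ 16 * hitEnergy p path E ν := by
  have hE : ∀ z ∈ E, path z ⊆ S₁ ∪ S₂ := fun z hz => by
    rw [hp]; exact Finset.union_subset_union (hp₁ z hz) (hp₂ z hz)
  rw [← coinMean_hitMass_sq h0 hE ν]
  -- Each filtration explores one tree in its planar order and contains every coin of the other
  -- tree, so `A k ∩ B l` consists of the coins explored in both.
  set A : ℕ → Finset N := fun k => (E.filter fun w => r w ≤ k).biUnion path₁ ∪ S₂ with hA
  set B : ℕ → Finset N := fun k => (E.filter fun w => s w ≤ k).biUnion path₂ ∪ S₁ with hB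
  have hAm : Monotone A := fun k l hkl => Finset.union_subset_union_left
    (Finset.biUnion_subset_biUnion_of_subset_left _
      (Finset.monotone_filter_right _ fun w _ (hw : r w ≤ k) => hw.trans hkl))
  have hBm : Monotone B := fun k l hkl => Finset.union_subset_union_left
    (Finset.biUnion_subset_biUnion_of_subset_left _
      (Finset.monotone_filter_right _ fun w _ (hw : s w ≤ k) => hw.trans hkl))
  -- Planarity enters here: for `z'` in the quadrant after `z`, the explored coins on the path of
  -- `z'` are exactly those shared with `z`. The conditional mean of its density is then the kernel.
  have hinter : ∀ z ∈ E, ∀ z' ∈ E, r z ≤ r z' → s z ≤ s z' →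
      path z' ∩ (A (r z) ∩ B (s z)) = path z ∩ path z' := by
    intro z hz z' hz' hrz hsz
    ext c
    have hdis : ¬ (c ∈ S₁ ∧ c ∈ S₂) := fun h => Finset.disjoint_left.1 hS h.1 h.2
    simp only [hA, hB, hp, Finset.mem_inter, Finset.mem_union, Finset.mem_biUnion,
      Finset.mem_filter]
    constructor
    · rintro ⟨hc | hc, ha, hb⟩
      · have hc1 := hp₁ z' hz' hc
        rcases ha with ⟨w, ⟨hw, hwr⟩, hcw⟩ | ha
        · exact ⟨Or.inl (hr w hw z hz z' hz' hwr hrz (Finset.mem_inter.2 ⟨hcw, hc⟩)), Or.inl hc⟩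
        · exact absurd ⟨hc1, ha⟩ hdis
      · have hc1 := hp₂ z' hz' hc
        rcases hb with ⟨w, ⟨hw, hwr⟩, hcw⟩ | hb
        · exact ⟨Or.inr (hs w hw z hz z' hz' hwr hsz (Finset.mem_inter.2 ⟨hcw, hc⟩)), Or.inr hc⟩
        · exact absurd ⟨hb, hc1⟩ hdis
    · rintro ⟨hc | hc, hc'⟩
      · exact ⟨hc', Or.inl ⟨z, ⟨hz, le_rfl⟩, hc⟩, Or.inr (hp₁ z hz hc)⟩
      · exact ⟨hc', Or.inr (hp₂ z hz hc), Or.inl ⟨z, ⟨hz, le_rfl⟩, hc⟩⟩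
  have hMnn : ∀ T, 0 ≤ hitMass p path E ν T := fun T => Finset.sum_nonneg fun z _ =>
    mul_nonneg (hν z) (by
      rw [hitDensity]; split_ifs
      exacts [inv_nonneg.2 (Finset.prod_nonneg fun c _ => (h0 c).le), le_rfl])
  have hDnn : ∀ z T, 0 ≤ hitDensity p path z T := fun z T => by
    rw [hitDensity]; split_ifs
    exacts [inv_nonneg.2 (Finset.prod_nonneg fun c _ => (h0 c).le), le_rfl]
  set g : Finset N → ℝ := fun T => if ∃ z ∈ E, path z ⊆ T then
    quadrantPotential p path E ν r s (σ T) else 0 with hg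
  have hg2 : (fun T => if ∃ z ∈ E, path z ⊆ T then
        quadrantPotential p path E ν r s (σ T) ^ 2 else 0) = fun T => g T ^ 2 := by
    funext T
    simp only [hg]; split_ifs <;> simp
  rw [hg2]
  refine cairoli_sq (fun c => (h0 c).le) h1 _ hAm hBm hMnn R (fun T => ?_) fun T hT => ?_
  · simp only [hg]; split_ifs
    exacts [quadrantPotential_nonneg h0 hν r s _, le_rfl]
  · have hT' : ∃ z ∈ E, path z ⊆ T := by
      by_contra hcon
      exact hT (by simp only [hg, if_neg hcon])
    obtain ⟨hz, hzT⟩ := hσ T hT'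
    refine ⟨r (σ T), hrR _ hz, s (σ T), hsR _ hz, ?_⟩
    simp only [hg, if_pos hT']
    set z := σ T
    have e : coinCond p (S₁ ∪ S₂) (A (r z) ∩ B (s z)) (hitMass p path E ν) T
        = ∑ z' ∈ E, ν z' *
          coinCond p (S₁ ∪ S₂) (A (r z) ∩ B (s z)) (hitDensity p path z') T := by
      simp only [coinCond, hitMass, coinMean_sum, coinMean_mul_left]
    rw [e]
    refine Finset.sum_le_sum fun z' hz' => ?_
    split_ifs with hq
    · have hi := hinter z hz z' hz' hq.1 hq.2
      rw [coinCond_hitDensity h0 (hE z' hz')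
        (by rw [hi]; exact Finset.inter_subset_left.trans hzT), hi, hitKernel]
    · exact mul_nonneg (hν z') (coinCond_nonneg (fun c => (h0 c).le) h1 (hDnn z') T)

/-- The capacity upper bound for the hitting probability, for a pair of independent planar trees;
the measure is the law of a hitting point. -/
theorem exists_hitProb_mul_hitEnergy_le {p : N → ℝ} (h0 : ∀ c, 0 < p c) (h1 : ∀ c, p c ≤ 1)
    {S₁ S₂ : Finset N} (hS : Disjoint S₁ S₂) {E : Finset Z} {path path₁ path₂ : Z → Finset N}
    (hp : ∀ z, path z = path₁ z ∪ path₂ z) (hp₁ : ∀ z ∈ E, path₁ z ⊆ S₁)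
    (hp₂ : ∀ z ∈ E, path₂ z ⊆ S₂) {r s : Z → ℕ} (hr : IsPlanarRank E path₁ r)
    (hs : IsPlanarRank E path₂ s) (hpos : 0 < hitProb p (S₁ ∪ S₂) path E) :
    ∃ ν : Z → ℝ, (∀ z, 0 ≤ ν z) ∧ ∑ z ∈ E, ν z = 1 ∧
      hitProb p (S₁ ∪ S₂) path E * hitEnergy p path E ν ≤ 256 := by
  classical
  set π := hitProb p (S₁ ∪ S₂) path E with hπ
  have hσ : ∀ T : Finset N, ∃ z : Z, (∃ z ∈ E, path z ⊆ T) → z ∈ E ∧ path z ⊆ T := by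
    intro T
    by_cases h : ∃ z ∈ E, path z ⊆ T
    · obtain ⟨z, hz⟩ := h; exact ⟨z, fun _ => hz⟩
    · have : Nonempty Z := by
        by_contra hZ
        rw [not_nonempty_iff] at hZ
        have : π = 0 := by
          rw [hπ, hitProb]
          simp [coinMean]
        exact hpos.ne' this
      exact ⟨this.some, fun h' => absurd h' h⟩
  choose σ hσ using hσ
  -- The law of the selected hitting point, conditioned on a hit.
  set ν : Z → ℝ := fun z =>
    coinMean p (S₁ ∪ S₂) (fun T => if (∃ z ∈ E, path z ⊆ T) ∧ σ T = z then 1 else 0) / π with hν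
  have hν0 : ∀ z, 0 ≤ ν z := fun z => div_nonneg (Finset.sum_nonneg fun T _ =>
    mul_nonneg (coinWeight_nonneg (fun c => (h0 c).le) h1 _ T) (by dsimp only; split_ifs <;> norm_num))
    hpos.le
  have hlaw : ∀ F : Z → ℝ, ∑ z ∈ E, ν z * F z
      = coinMean p (S₁ ∪ S₂) (fun T => if ∃ z ∈ E, path z ⊆ T then F (σ T) else 0) / π := by
    intro F
    have e : ∀ T, (if ∃ z ∈ E, path z ⊆ T then F (σ T) else 0)
        = ∑ z ∈ E, F z * if (∃ z ∈ E, path z ⊆ T) ∧ σ T = z then 1 else 0 := by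
      intro T
      by_cases hT : ∃ z ∈ E, path z ⊆ T
      · simp only [hT, true_and, mul_ite, mul_one, mul_zero, if_true]
        rw [Finset.sum_ite_eq, if_pos (hσ T hT).1]
      · simp [hT]
    rw [funext e, coinMean_sum, Finset.sum_div]
    refine Finset.sum_congr rfl fun z _ => ?_
    rw [coinMean_mul_left, hν]
    ring
  have hν1 : ∑ z ∈ E, ν z = 1 := by
    have := hlaw (fun _ => 1)
    simp only [mul_one] at this
    rw [this]
    exact div_self hpos.ne'
  refine ⟨ν, hν0, hν1, ?_⟩
  set R := E.sup r + E.sup s with hR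
  have hrR : ∀ z ∈ E, r z ≤ R := fun z hz => (Finset.le_sup (f := r) hz).trans (by omega)
  have hsR : ∀ z ∈ E, s z ≤ R := fun z hz => (Finset.le_sup (f := s) hz).trans (by omega)
  -- Reversing the ranks preserves planarity and yields the other three quadrants.
  set r' : Z → ℕ := fun z => R - r z with hr'
  set s' : Z → ℕ := fun z => R - s z with hs'
  have hr'R : ∀ z ∈ E, r' z ≤ R := fun z _ => Nat.sub_le _ _
  have hs'R : ∀ z ∈ E, s' z ≤ R := fun z _ => Nat.sub_le _ _
  set Q := quadrantPotential p path E ν with hQ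
  have hquad : ∀ r s : Z → ℕ, IsPlanarRank E path₁ r → IsPlanarRank E path₂ s →
      (∀ z ∈ E, r z ≤ R) → (∀ z ∈ E, s z ≤ R) →
      ∑ z ∈ E, ν z * Q r s z ^ 2 ≤ 16 * hitEnergy p path E ν / π := by
    intro r s hr hs hrR hsR
    rw [hlaw]
    exact div_le_div_of_nonneg_right
      (coinMean_quadrantPotential_sq_le h0 h1 hS hp hp₁ hp₂ hr hs hrR hsR hν0 hσ) hpos.le
  have q1 := hquad r s hr hs hrR hsR
  have q2 := hquad r' s (hr.reverse hrR) hs hr'R hsR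
  have q3 := hquad r s' hr (hs.reverse hsR) hrR hs'R
  have q4 := hquad r' s' (hr.reverse hrR) (hs.reverse hsR) hr'R hs'R
  set U : Z → ℝ := fun z => ∑ z' ∈ E, ν z' * hitKernel p path z z' with hU
  have hU0 : ∀ z, 0 ≤ U z := fun z => Finset.sum_nonneg fun z' _ =>
    mul_nonneg (hν0 z') (hitKernel_pos h0 path z z').le
  have hUQ : ∀ z ∈ E, U z ≤ Q r s z + Q r' s z + Q r s' z + Q r' s' z := by
    intro z hz
    simp only [hQ, quadrantPotential, ← Finset.sum_add_distrib, hU]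
    refine Finset.sum_le_sum fun z' hz' => ?_
    have hk := mul_nonneg (hν0 z') (hitKernel_pos h0 path z z').le
    have i1 : r z ≤ r z' ∨ r' z ≤ r' z' := by simp only [hr']; omega
    have i2 : s z ≤ s z' ∨ s' z ≤ s' z' := by simp only [hs']; omega
    have hi : ∀ (c : Prop) [Decidable c],
        0 ≤ if c then ν z' * hitKernel p path z z' else 0 := by
      intro c _; split_ifs <;> simp [hk]
    have j1 := hi (r z ≤ r z' ∧ s z ≤ s z')
    have j2 := hi (r' z ≤ r' z' ∧ s z ≤ s z')
    have j3 := hi (r z ≤ r z' ∧ s' z ≤ s' z')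
    have j4 := hi (r' z ≤ r' z' ∧ s' z ≤ s' z')
    rcases i1 with a | a <;> rcases i2 with b | b
    · rw [if_pos (⟨a, b⟩ : r z ≤ r z' ∧ s z ≤ s z')]; linarith
    · rw [if_pos (⟨a, b⟩ : r z ≤ r z' ∧ s' z ≤ s' z')]; linarith
    · rw [if_pos (⟨a, b⟩ : r' z ≤ r' z' ∧ s z ≤ s z')]; linarith
    · rw [if_pos (⟨a, b⟩ : r' z ≤ r' z' ∧ s' z ≤ s' z')]; linarith
  -- The constant is 4 from squaring a sum of four terms, times four quadrants, times 16 from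
  -- Cairoli.
  have hUsq : ∑ z ∈ E, ν z * U z ^ 2 ≤ 256 * hitEnergy p path E ν / π := by
    have : ∑ z ∈ E, ν z * U z ^ 2 ≤ ∑ z ∈ E, 4 * (ν z * Q r s z ^ 2 + ν z * Q r' s z ^ 2
        + ν z * Q r s' z ^ 2 + ν z * Q r' s' z ^ 2) := by
      refine Finset.sum_le_sum fun z hz => ?_
      have a := pow_le_pow_left₀ (hU0 z) (hUQ z hz) 2
      have b : (Q r s z + Q r' s z + Q r s' z + Q r' s' z) ^ 2
          ≤ 4 * (Q r s z ^ 2 + Q r' s z ^ 2 + Q r s' z ^ 2 + Q r' s' z ^ 2) := by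
        nlinarith [sq_nonneg (Q r s z - Q r' s z), sq_nonneg (Q r s z - Q r s' z),
          sq_nonneg (Q r s z - Q r' s' z), sq_nonneg (Q r' s z - Q r s' z),
          sq_nonneg (Q r' s z - Q r' s' z), sq_nonneg (Q r s' z - Q r' s' z)]
      have := mul_le_mul_of_nonneg_left (a.trans b) (hν0 z)
      linarith
    rw [← Finset.mul_sum, Finset.sum_add_distrib, Finset.sum_add_distrib,
      Finset.sum_add_distrib] at this
    have e : 256 * hitEnergy p path E ν / π = 16 * (16 * hitEnergy p path E ν / π) := by ring
    linarith
  have hen : hitEnergy p path E ν = ∑ z ∈ E, ν z * U z := by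
    simp only [hitEnergy, hU, Finset.mul_sum, mul_assoc]
  -- Jensen's inequality: the energy is the `ν`-mean of the potential `U`.
  have hcs : hitEnergy p path E ν ^ 2 ≤ ∑ z ∈ E, ν z * U z ^ 2 := by
    obtain ⟨a, ha⟩ : ∃ a, a = ∑ z ∈ E, ν z * U z := ⟨_, rfl⟩
    have h2 : 0 ≤ ∑ z ∈ E, ν z * (U z - a) ^ 2 :=
      Finset.sum_nonneg fun z _ => mul_nonneg (hν0 z) (sq_nonneg _)
    have h3 : ∑ z ∈ E, ν z * (U z - a) ^ 2
        = ∑ z ∈ E, ν z * U z ^ 2 - 2 * a * ∑ z ∈ E, ν z * U z + a ^ 2 * ∑ z ∈ E, ν z := by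
      rw [Finset.mul_sum, Finset.mul_sum, ← Finset.sum_sub_distrib, ← Finset.sum_add_distrib]
      exact Finset.sum_congr rfl fun z _ => by ring
    rw [hν1, ← ha] at h3
    rw [hen, ← ha]
    nlinarith
  have hEn0 : 0 ≤ hitEnergy p path E ν := by
    rw [hen]; exact Finset.sum_nonneg fun z _ => mul_nonneg (hν0 z) (hU0 z)
  rcases hEn0.eq_or_lt with h | h
  · rw [← h]; norm_num
  · have := hcs.trans hUsq
    rw [le_div_iff₀ hpos] at this
    nlinarith

end Hitting

/-! ### Dyadic cubes, retained cubes as coin paths, and a planar order on the tree. -/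

section Cells

variable {d : ℕ}

/-- The index of the dyadic cube of side length `2 ^ i` containing `v`. -/
def anc (i : ℕ) (v : Fin d → ℤ) : Fin d → ℤ := fun l => v l / 2 ^ i

lemma anc_zero (v : Fin d → ℤ) : anc 0 v = v := by
  funext l; simp [anc]

lemma anc_anc (i j : ℕ) (v : Fin d → ℤ) : anc i (anc j v) = anc (j + i) v := by
  funext l
  simp only [anc]
  rw [Int.ediv_ediv_of_nonneg (by positivity), pow_add]

lemma anc_eq_of_le {i j : ℕ} (h : i ≤ j) {v w : Fin d → ℤ} (e : anc i v = anc i w) :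
    anc j v = anc j w := by
  obtain ⟨k, rfl⟩ := Nat.exists_eq_add_of_le h
  rw [← anc_anc, ← anc_anc, e]

/-- The lattice points of `[-2^(k-1), 2^(k-1))^d`. -/
def box (d k : ℕ) : Finset (Fin d → ℤ) :=
  Fintype.piFinset fun _ => Finset.Ico (-(2 : ℤ) ^ (k - 1)) (2 ^ (k - 1))

lemma mem_box {k : ℕ} {v : Fin d → ℤ} :
    v ∈ box d k ↔ ∀ l, -(2 : ℤ) ^ (k - 1) ≤ v l ∧ v l < 2 ^ (k - 1) := by
  simp [box, Fintype.mem_piFinset]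

/-- The case `k = 0` fails because the truncated exponent `k - 1` makes `box d 0` and `box d 1`
equal. -/
lemma anc_one_mem_box {k : ℕ} (hk : 1 ≤ k) {v : Fin d → ℤ} :
    anc 1 v ∈ box d k ↔ v ∈ box d (k + 1) := by
  simp only [mem_box, anc, pow_one]
  refine forall_congr' fun l => ?_
  obtain ⟨k, rfl⟩ := Nat.exists_eq_add_of_le' hk
  have : (2 : ℤ) ^ (k + 1) = 2 * 2 ^ k := by rw [pow_succ]; ring
  simp only [Nat.add_sub_cancel, this]
  omega

lemma self_mem_dyadicCube (k : ℕ) (v : Fin d → ℤ) :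
    (fun l => (v l : ℝ) / 2 ^ k) ∈ dyadicCube k v := fun l => by
  have h2 : (0 : ℝ) < 2 ^ k := by positivity
  exact ⟨le_rfl, (div_lt_div_iff_of_pos_right h2).2 (by linarith)⟩

lemma dyadicCube_succ_subset {k : ℕ} {v w : Fin d → ℤ} :
    dyadicCube (k + 1) v ⊆ dyadicCube k w ↔ anc 1 v = w := by
  have h2 : (0 : ℝ) < 2 ^ k := by positivity
  have e : ∀ a : ℝ, a / 2 ^ (k + 1) = (a / 2) / 2 ^ k := fun a => by
    rw [pow_succ]; field_simp
  constructor
  · intro h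
    funext l
    obtain ⟨h1, h3⟩ := h (self_mem_dyadicCube (k + 1) v) l
    simp only at h1 h3
    rw [e, div_le_div_iff_of_pos_right h2] at h1
    rw [e, div_lt_div_iff_of_pos_right h2] at h3
    have h1' : w l * 2 ≤ v l := by
      have : (w l : ℝ) * 2 ≤ v l := by linarith
      exact_mod_cast this
    have h3' : v l < (w l + 1) * 2 := by
      have : (v l : ℝ) < (w l + 1) * 2 := by linarith
      exact_mod_cast this
    simp only [anc, pow_one]
    omega
  · rintro rfl x hx l
    obtain ⟨h1, h3⟩ := hx l
    rw [e] at h1 h3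
    have h1' : ((v l / 2 : ℤ) : ℝ) ≤ (v l : ℝ) / 2 := by
      have : (v l / 2) * 2 ≤ v l := by omega
      have : ((v l / 2 : ℤ) : ℝ) * 2 ≤ v l := by exact_mod_cast this
      linarith
    have h3' : ((v l : ℝ) + 1) / 2 ≤ ((v l / 2 : ℤ) : ℝ) + 1 := by
      have : v l + 1 ≤ (v l / 2 + 1) * 2 := by omega
      have : (v l : ℝ) + 1 ≤ (((v l / 2 : ℤ) : ℝ) + 1) * 2 := by exact_mod_cast this
      linarith
    simp only [anc, pow_one]
    exact ⟨((div_le_div_iff_of_pos_right h2).2 h1').trans h1,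
      h3.trans_le ((div_le_div_iff_of_pos_right h2).2 h3')⟩

lemma dyadicCube_one_subset {v : Fin d → ℤ} : dyadicCube 1 v ⊆ unitCube d ↔ v ∈ box d 1 := by
  simp only [mem_box, Nat.sub_self, pow_zero]
  constructor
  · intro h l
    obtain ⟨h1, h3⟩ := h (self_mem_dyadicCube 1 v) l
    simp only [pow_one] at h1 h3
    have h1' : (-1 : ℝ) ≤ v l := by linarith
    have h3' : (v l : ℝ) < 1 := by linarith
    exact ⟨by exact_mod_cast h1', by exact_mod_cast h3'⟩
  · intro h x hx l
    obtain ⟨h1, h3⟩ := hx l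
    simp only [pow_one] at h1 h3
    have h1' : (-1 : ℝ) ≤ v l := by exact_mod_cast (h l).1
    have h3' : (v l : ℝ) + 1 ≤ 1 := by
      have := (h l).2
      exact_mod_cast this
    constructor <;> linarith

lemma smul_dyadicCube_mem {k : ℕ} {v x : Fin d → ℤ} :
    (fun l => (x l : ℝ)) ∈ (2 : ℝ) ^ k • dyadicCube k v ↔ x = v := by
  have h2 : (0 : ℝ) < 2 ^ k := by positivity
  rw [Set.mem_smul_set_iff_inv_smul_mem₀ h2.ne']
  constructor
  · intro h
    funext l
    obtain ⟨h1, h3⟩ := h l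
    simp only [Pi.smul_apply, smul_eq_mul, inv_mul_eq_div] at h1 h3
    rw [div_le_div_iff_of_pos_right h2] at h1
    rw [div_lt_div_iff_of_pos_right h2] at h3
    have h1' : v l ≤ x l := by exact_mod_cast h1
    have h3' : x l < v l + 1 := by exact_mod_cast h3
    omega
  · rintro rfl
    have : ((2 : ℝ) ^ k)⁻¹ • (fun l => (x l : ℝ)) = fun l => (x l : ℝ) / 2 ^ k := by
      funext l; simp [div_eq_inv_mul]
    rw [this]
    exact self_mem_dyadicCube k x

/-- The starting cube is centred and is not itself a `dyadicCube` of generation zero. The recursion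
is therefore anchored at generation one, with `box` recording containment in the starting cube. -/
lemma mem_retained_succ {Ω : Type*} [MeasurableSpace Ω] (ξ : ℕ × (Fin d → ℤ) → Ω → Bool) (ω : Ω)
    (k : ℕ) (C : Set (Fin d → ℝ)) :
    C ∈ retained ξ ω (k + 1) ↔ ∃ v, C = dyadicCube (k + 1) v ∧ v ∈ box d (k + 1) ∧
      ∀ i < k + 1, ξ (k + 1 - i, anc i v) ω = true := by
  induction k generalizing C with
  | zero =>
    constructor
    · rintro ⟨D, rfl, v, rfl, hs, hv⟩
      refine ⟨v, rfl, dyadicCube_one_subset.1 hs, fun i hi => ?_⟩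
      obtain rfl : i = 0 := by omega
      rwa [anc_zero]
    · rintro ⟨v, rfl, hv, h⟩
      refine ⟨unitCube d, rfl, v, rfl, dyadicCube_one_subset.2 hv, ?_⟩
      simpa [anc_zero] using h 0 (by omega)
  | succ k ih =>
    constructor
    · rintro ⟨D, hD, v, rfl, hs, hv⟩
      obtain ⟨w, rfl, hw, h⟩ := (ih D).1 hD
      obtain rfl := dyadicCube_succ_subset.1 hs
      refine ⟨v, rfl, (anc_one_mem_box (by omega)).1 hw, fun i hi => ?_⟩
      rcases i with _ | i
      · rwa [anc_zero]
      · have := h i (by omega)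
        rw [anc_anc, add_comm 1 i] at this
        rwa [Nat.add_sub_add_right]
    · rintro ⟨v, rfl, hv, h⟩
      refine ⟨dyadicCube (k + 1) (anc 1 v), (ih _).2 ⟨anc 1 v, rfl,
        (anc_one_mem_box (by omega)).2 hv, fun i hi => ?_⟩, v, rfl,
        dyadicCube_succ_subset.2 rfl, ?_⟩
      · have := h (i + 1) (by omega)
        rw [anc_anc, add_comm 1 i]
        rwa [Nat.add_sub_add_right] at this
      · simpa [anc_zero] using h 0 (by omega)

/-- The coins deciding whether `x` belongs to the discrete fractal percolation of depth `m`. -/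
def cellPath (m : ℕ) (x : Fin d → ℤ) : Finset (ℕ × (Fin d → ℤ)) :=
  (Finset.range m).image fun i => (m - i, anc i x)

lemma mem_discretePerc {Ω : Type*} [MeasurableSpace Ω] (ξ : ℕ × (Fin d → ℤ) → Ω → Bool) (ω : Ω)
    {m : ℕ} (hm : 1 ≤ m) (x : Fin d → ℤ) :
    x ∈ discretePerc ξ m ω ↔ x ∈ box d m ∧ ∀ c ∈ cellPath m x, ξ c ω = true := by
  obtain ⟨k, rfl⟩ := Nat.exists_eq_add_of_le' hm
  simp only [discretePerc, Set.mem_ofPred_eq, Set.mem_iUnion, mem_retained_succ, exists_prop]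
  constructor
  · rintro ⟨C, ⟨v, rfl, hv, h⟩, hx⟩
    obtain rfl := smul_dyadicCube_mem.1 hx
    exact ⟨hv, fun c hc => by
      obtain ⟨i, hi, rfl⟩ := Finset.mem_image.1 hc
      exact h i (Finset.mem_range.1 hi)⟩
  · rintro ⟨hx, h⟩
    exact ⟨_, ⟨x, rfl, hx, fun i hi => h _ (Finset.mem_image_of_mem _ (Finset.mem_range.2 hi))⟩,
      smul_dyadicCube_mem.2 rfl⟩

lemma mem_cellPath_iff {m i : ℕ} (hi : i < m) {x v : Fin d → ℤ} :
    (m - i, v) ∈ cellPath m x ↔ v = anc i x := by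
  simp only [cellPath, Finset.mem_image, Finset.mem_range, Prod.mk.injEq]
  constructor
  · rintro ⟨j, hj, h1, rfl⟩
    congr 1; omega
  · rintro rfl; exact ⟨i, hi, rfl, rfl⟩

lemma card_cellPath_inter (m : ℕ) (x x' : Fin d → ℤ) :
    (cellPath m x ∩ cellPath m x').card
      = ((Finset.range m).filter fun i => anc i x = anc i x').card := by
  symm
  refine Finset.card_bij (fun i _ => (m - i, anc i x)) ?_ ?_ ?_
  · intro i hi
    rw [Finset.mem_filter, Finset.mem_range] at hi
    rw [Finset.mem_inter, mem_cellPath_iff hi.1, mem_cellPath_iff hi.1]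
    exact ⟨rfl, hi.2⟩
  · intro i hi j hj h
    simp only [Finset.mem_filter, Finset.mem_range] at hi hj
    simp only [Prod.mk.injEq] at h
    omega
  · intro c hc
    rw [Finset.mem_inter] at hc
    obtain ⟨i, hi, rfl⟩ := Finset.mem_image.1 hc.1
    rw [Finset.mem_range] at hi
    exact ⟨i, Finset.mem_filter.2 ⟨Finset.mem_range.2 hi, (mem_cellPath_iff hi).1 hc.2⟩, rfl⟩

/-- The number with digits `f 0, …, f (m - 1)` in base `B`. -/
def digitSum (B : ℕ) : ℕ → (ℕ → ℕ) → ℕ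
  | 0, _ => 0
  | m + 1, f => f 0 + B * digitSum B m fun i => f (i + 1)

lemma digitSum_div_pow {B : ℕ} {m k : ℕ} {f : ℕ → ℕ} (hf : ∀ i < m, f i < B) (hk : k ≤ m) :
    digitSum B m f / B ^ k = digitSum B (m - k) fun i => f (i + k) := by
  induction k generalizing m f with
  | zero => simp
  | succ k ih =>
    obtain ⟨m, rfl⟩ := Nat.exists_eq_add_of_le' (Nat.lt_of_lt_of_le k.succ_pos hk)
    have hB : f 0 < B := hf 0 (by omega)
    rw [pow_succ', ← Nat.div_div_eq_div_mul, digitSum,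
      Nat.add_mul_div_left _ _ (by omega : 0 < B), Nat.div_eq_of_lt hB, zero_add,
      ih (fun i hi => hf (i + 1) (by omega)) (by omega), Nat.add_sub_add_right]
    simp only [add_assoc]

lemma digitSum_congr {B m : ℕ} {f g : ℕ → ℕ} (h : ∀ i < m, f i = g i) :
    digitSum B m f = digitSum B m g := by
  induction m generalizing f g with
  | zero => rfl
  | succ m ih => rw [digitSum, digitSum, h 0 (by omega), ih fun i hi => h (i + 1) (by omega)]

lemma digitSum_mod {B m : ℕ} (hm : 0 < m) {f : ℕ → ℕ} (hf : f 0 < B) :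
    digitSum B m f % B = f 0 := by
  obtain ⟨m, rfl⟩ := Nat.exists_eq_add_of_le' hm
  rw [digitSum, Nat.add_mul_mod_self_left, Nat.mod_eq_of_lt hf]

/-- Lexicographic order of the ancestral lines, coarsest cube first. The rank is a number in base
`B` whose digits encode the ancestors, so division by `B ^ i` keeps exactly the ancestors at heights
at least `i`. -/
lemma exists_planarRank (m : ℕ) (X : Finset (Fin d → ℤ)) :
    ∃ r : (Fin d → ℤ) → ℕ, IsPlanarRank X (cellPath m) r := by
  set e : ℕ × (Fin d → ℤ) → ℕ := Encodable.encode with he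
  set B := (X.biUnion (cellPath m)).sup e + 1 with hB
  set f : (Fin d → ℤ) → ℕ → ℕ := fun x i => e (m - i, anc i x) with hf
  have hlt : ∀ x ∈ X, ∀ i < m, f x i < B := fun x hx i hi => by
    refine Nat.lt_succ_of_le (Finset.le_sup (f := e) (Finset.mem_biUnion.2 ⟨x, hx, ?_⟩))
    exact (mem_cellPath_iff hi).2 rfl
  refine ⟨fun x => digitSum B m (f x), fun w hw z hz z' hz' h1 h2 c hc => ?_⟩
  rw [Finset.mem_inter] at hc
  obtain ⟨i, hi, rfl⟩ := Finset.mem_image.1 hc.1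
  rw [Finset.mem_range] at hi
  have hanc := (mem_cellPath_iff hi).1 hc.2
  -- A shared cube at height `i` forces all coarser ancestors to agree, so `w` and `z'` have the
  -- same quotient; monotone division gives it to `z` as well.
  have hww : digitSum B m (f w) / B ^ i = digitSum B m (f z') / B ^ i := by
    rw [digitSum_div_pow (hlt w hw) hi.le, digitSum_div_pow (hlt z' hz') hi.le]
    refine digitSum_congr fun j _ => ?_
    simp only [hf, anc_eq_of_le (Nat.le_add_left i j) hanc]
  have hwz : digitSum B m (f w) / B ^ i = digitSum B m (f z) / B ^ i :=
    le_antisymm (Nat.div_le_div_right h1) (hww ▸ Nat.div_le_div_right h2)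
  rw [digitSum_div_pow (hlt w hw) hi.le, digitSum_div_pow (hlt z hz) hi.le] at hwz
  have := congrArg (· % B) hwz
  rw [digitSum_mod (by omega) (by simpa using hlt w hw i hi),
    digitSum_mod (by omega) (by simpa using hlt z hz i hi)] at this
  simp only [zero_add, hf, he] at this
  have := Encodable.encode_injective this
  rw [mem_cellPath_iff hi]
  exact (Prod.mk.inj this).2

end Cells

/-! ### Transfer from the probability space to the finite coin model. -/

section Law

variable {d : ℕ} {Ω : Type*} [MeasurableSpace Ω] {P : Measure Ω} [IsProbabilityMeasure P]

lemma IsCoinField.measureReal_eq {p : ℝ} (hp : 0 ≤ p) {ξ : ℕ × (Fin d → ℤ) → Ω → Bool}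
    (h : IsCoinField p P ξ) (c : ℕ × (Fin d → ℤ)) (b : Bool) :
    P.real (ξ c ⁻¹' {b}) = if b = true then p else 1 - p := by
  have h1 : P.real (ξ c ⁻¹' {true}) = p := by
    rw [Measure.real]
    change (P {ω | ξ c ω = true}).toReal = p
    rw [h.prob, ENNReal.toReal_ofReal hp]
  cases b
  · have : ξ c ⁻¹' {false} = (ξ c ⁻¹' {true})ᶜ := by
      ext ω; simp
    rw [this, probReal_compl_eq_one_sub (h.measurable c (measurableSet_singleton _)), h1]
    simp
  · simp [h1]

lemma IsCoinField.measureReal_inter {p : ℝ} (hp : 0 ≤ p) {ξ : ℕ × (Fin d → ℤ) → Ω → Bool}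
    (h : IsCoinField p P ξ) (S : Finset (ℕ × (Fin d → ℤ))) (b : ℕ × (Fin d → ℤ) → Bool) :
    P.real (⋂ c ∈ S, ξ c ⁻¹' {b c}) = ∏ c ∈ S, if b c = true then p else 1 - p := by
  rw [Measure.real, h.indep.measure_inter_preimage_eq_mul S
    (fun c _ => measurableSet_singleton _), ENNReal.toReal_prod]
  exact Finset.prod_congr rfl fun c _ => h.measureReal_eq hp c (b c)

lemma measureReal_coins {p q : ℝ} (hp : 0 ≤ p) (hq : 0 ≤ q)
    {ξ η : ℕ × (Fin d → ℤ) → Ω → Bool} (hξ : IsCoinField p P ξ) (hη : IsCoinField q P η)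
    (hind : IndepFun (fun ω c => ξ c ω) (fun ω c => η c ω) P)
    (S₁ S₂ : Finset (ℕ × (Fin d → ℤ)))
    (F : Finset ((ℕ × (Fin d → ℤ)) ⊕ (ℕ × (Fin d → ℤ))) → Prop) [DecidablePred F] :
    P.real {ω | F ((S₁.disjSum S₂).filter fun c => Sum.elim ξ η c ω = true)}
      = coinMean (Sum.elim (fun _ => p) fun _ => q) (S₁.disjSum S₂)
        (fun T => if F T then 1 else 0) := by
  classical
  set S := S₁.disjSum S₂ with hS
  set X : Ω → Finset ((ℕ × (Fin d → ℤ)) ⊕ (ℕ × (Fin d → ℤ))) :=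
    fun ω => S.filter fun c => Sum.elim ξ η c ω = true with hX
  have hlaw : ∀ T ⊆ S, MeasurableSet {ω | X ω = T} ∧
      P.real {ω | X ω = T} = coinWeight (Sum.elim (fun _ => p) fun _ => q) S T := by
    intro T hT
    set b₁ : ℕ × (Fin d → ℤ) → Bool := fun c => decide (Sum.inl c ∈ T)
    set b₂ : ℕ × (Fin d → ℤ) → Bool := fun c => decide (Sum.inr c ∈ T)
    have hb : ∀ (a : Bool) (r : Prop) [Decidable r], a = decide r ↔ (a = true ↔ r) := by
      intro a r _; cases a <;> simp
    have e : {ω | X ω = T}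
        = (⋂ c ∈ S₁, ξ c ⁻¹' {b₁ c}) ∩ ⋂ c ∈ S₂, η c ⁻¹' {b₂ c} := by
      ext ω
      simp only [Set.mem_ofPred_eq, Set.mem_inter_iff, Set.mem_iInter, Set.mem_preimage,
        Set.mem_singleton_iff, hX, b₁, b₂, hb]
      constructor
      · intro h
        exact ⟨fun c hc => by rw [← h]; simp [hS, hc], fun c hc => by rw [← h]; simp [hS, hc]⟩
      · rintro ⟨h1, h2⟩
        ext c
        rw [Finset.mem_filter]
        constructor
        · rcases c with c | c
          · rintro ⟨hc, h⟩
            exact (h1 c (by simpa [hS] using hc)).1 h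
          · rintro ⟨hc, h⟩
            exact (h2 c (by simpa [hS] using hc)).1 h
        · intro hc
          refine ⟨hT hc, ?_⟩
          rcases c with c | c
          · exact (h1 c (by simpa [hS] using hT hc)).2 hc
          · exact (h2 c (by simpa [hS] using hT hc)).2 hc
    have m1 : MeasurableSet (⋂ c ∈ S₁, ξ c ⁻¹' {b₁ c}) :=
      S₁.measurableSet_biInter fun c _ => hξ.measurable c (measurableSet_singleton _)
    have m2 : MeasurableSet (⋂ c ∈ S₂, η c ⁻¹' {b₂ c}) :=
      S₂.measurableSet_biInter fun c _ => hη.measurable c (measurableSet_singleton _)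
    refine ⟨e ▸ m1.inter m2, ?_⟩
    have hprod : P ((⋂ c ∈ S₁, ξ c ⁻¹' {b₁ c}) ∩ ⋂ c ∈ S₂, η c ⁻¹' {b₂ c})
        = P (⋂ c ∈ S₁, ξ c ⁻¹' {b₁ c}) * P (⋂ c ∈ S₂, η c ⁻¹' {b₂ c}) := by
      have := hind.measure_inter_preimage_eq_mul
        (⋂ c ∈ S₁, (fun g : ℕ × (Fin d → ℤ) → Bool => g c) ⁻¹' {b₁ c})
        (⋂ c ∈ S₂, (fun g : ℕ × (Fin d → ℤ) → Bool => g c) ⁻¹' {b₂ c})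
        (S₁.measurableSet_biInter fun c _ => measurable_pi_apply c (measurableSet_singleton _))
        (S₂.measurableSet_biInter fun c _ => measurable_pi_apply c (measurableSet_singleton _))
      simpa only [Set.preimage_iInter, ← Set.preimage_comp, Function.comp_def] using this
    rw [e, Measure.real, hprod, ENNReal.toReal_mul, ← Measure.real, ← Measure.real,
      hξ.measureReal_inter hp, hη.measureReal_inter hq, coinWeight_eq_prod _ hT, hS,
      Finset.prod_disjSum]
    simp [b₁, b₂]
  have hu : {ω | F (X ω)} = ⋃ T ∈ S.powerset.filter F, {ω | X ω = T} := by
    ext ω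
    simp only [Set.mem_ofPred_eq, Set.mem_iUnion, Finset.mem_filter, Finset.mem_powerset,
      exists_prop]
    constructor
    · exact fun h => ⟨X ω, ⟨Finset.filter_subset _ _, h⟩, rfl⟩
    · rintro ⟨T, ⟨_, h⟩, rfl⟩; exact h
  rw [hu, measureReal_biUnion_finset]
  · rw [coinMean, Finset.sum_filter]
    refine Finset.sum_congr rfl fun T hT => ?_
    rw [(hlaw T (Finset.mem_powerset.1 hT)).2]
    split_ifs <;> simp
  · intro T _ T' _ hTT'
    refine Set.disjoint_left.2 fun ω h h' => hTT' ?_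
    exact Eq.trans (Eq.symm h) h'
  · intro T hT
    exact (hlaw T (Finset.mem_powerset.1 (Finset.mem_filter.1 hT).1)).1

/-- The coins deciding whether `x` and `y` belong to the two percolations. -/
def pairPath {d : ℕ} (m n : ℕ) (z : (Fin d → ℤ) × (Fin d → ℤ)) :
    Finset ((ℕ × (Fin d → ℤ)) ⊕ (ℕ × (Fin d → ℤ))) :=
  (cellPath m z.1).disjSum (cellPath n z.2)

/-- The pairs of points of the two boxes with sum in `A`. -/
def pairsInto {d : ℕ} (m n : ℕ) (A : Finset (Fin d → ℤ)) :
    Finset ((Fin d → ℤ) × (Fin d → ℤ)) :=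
  (box d m ×ˢ box d n).filter fun z => z.1 + z.2 ∈ A

/-- The coins that matter for the two percolations. -/
def boxCoins (d m : ℕ) : Finset (ℕ × (Fin d → ℤ)) := (box d m).biUnion (cellPath m)

lemma measureReal_hit_eq_hitProb {p q : ℝ} (hp : 0 ≤ p) (hq : 0 ≤ q)
    {ξ η : ℕ × (Fin d → ℤ) → Ω → Bool} (hξ : IsCoinField p P ξ) (hη : IsCoinField q P η)
    (hind : IndepFun (fun ω c => ξ c ω) (fun ω c => η c ω) P) {m n : ℕ} (hm : 1 ≤ m)
    (hn : 1 ≤ n) (A : Finset (Fin d → ℤ)) :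
    P.real {ω | ((discretePerc ξ m ω + discretePerc η n ω) ∩ (A : Set (Fin d → ℤ))).Nonempty}
      = hitProb (Sum.elim (fun _ => p) fun _ => q) ((boxCoins d m).disjSum (boxCoins d n))
        (pairPath m n) (pairsInto m n A) := by
  classical
  rw [hitProb, ← measureReal_coins hp hq hξ hη hind]
  congr 1
  ext ω
  simp only [Set.mem_ofPred_eq]
  constructor
  · rintro ⟨a, ⟨x, hx, y, hy, rfl⟩, ha⟩
    rw [mem_discretePerc ξ ω hm] at hx
    rw [mem_discretePerc η ω hn] at hy
    refine ⟨(x, y), Finset.mem_filter.2 ⟨Finset.mem_product.2 ⟨hx.1, hy.1⟩, ha⟩, ?_⟩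
    intro c hc
    rw [Finset.mem_filter]
    rcases c with c | c
    · have hc : c ∈ cellPath m x := by simpa [pairPath] using hc
      exact ⟨Finset.inl_mem_disjSum.2 (Finset.mem_biUnion.2 ⟨x, hx.1, hc⟩), hx.2 c hc⟩
    · have hc : c ∈ cellPath n y := by simpa [pairPath] using hc
      exact ⟨Finset.inr_mem_disjSum.2 (Finset.mem_biUnion.2 ⟨y, hy.1, hc⟩), hy.2 c hc⟩
  · rintro ⟨⟨x, y⟩, hz, hs⟩
    obtain ⟨hz, ha⟩ := Finset.mem_filter.1 hz
    obtain ⟨hx, hy⟩ := Finset.mem_product.1 hz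
    refine ⟨x + y, Set.add_mem_add ((mem_discretePerc ξ ω hm x).2 ⟨hx, fun c hc => ?_⟩)
      ((mem_discretePerc η ω hn y).2 ⟨hy, fun c hc => ?_⟩), ha⟩
    · exact (Finset.mem_filter.1 (hs (Finset.inl_mem_disjSum.2 hc))).2
    · exact (Finset.mem_filter.1 (hs (Finset.inr_mem_disjSum.2 hc))).2

end Law

/-! ### Dyadic size of lattice vectors, heights of common cubes, and the convolution estimate. -/

section Levels

variable {d : ℕ}

/-- The smallest `i` such that all coordinates of `z` are less than `2 ^ i` in absolute value. -/
def lev (z : Fin d → ℤ) : ℕ := Finset.univ.sup fun l => (z l).natAbs.size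

lemma lev_le_iff {z : Fin d → ℤ} {i : ℕ} : lev z ≤ i ↔ ∀ l, (z l).natAbs < 2 ^ i := by
  simp [lev, Finset.sup_le_iff, Nat.size_le]

lemma natAbs_lt_two_pow_lev (z : Fin d → ℤ) (l : Fin d) : (z l).natAbs < 2 ^ lev z :=
  lev_le_iff.1 le_rfl l

lemma exists_two_pow_le {z : Fin d → ℤ} {i : ℕ} (h : i < lev z) :
    ∃ l, 2 ^ i ≤ (z l).natAbs := by
  by_contra! hcon
  exact absurd (lev_le_iff.2 hcon) (by omega)

lemma lev_add_le (z w : Fin d → ℤ) : lev (z + w) ≤ max (lev z) (lev w) + 1 := by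
  rw [lev_le_iff]
  intro l
  have h1 := lev_le_iff.1 (le_max_left (lev z) (lev w)) l
  have h2 := lev_le_iff.1 (le_max_right (lev z) (lev w)) l
  have := Int.natAbs_add_le (z l) (w l)
  rw [pow_succ]
  simp only [Pi.add_apply]
  omega

lemma card_box {k : ℕ} : (box d (k + 1)).card = 2 ^ (d * (k + 1)) := by
  rw [box, Fintype.card_piFinset]
  simp only [Int.card_Ico, Nat.add_sub_cancel, Finset.prod_const, Finset.card_univ,
    Fintype.card_fin]
  have : ((2 : ℤ) ^ k - -2 ^ k).toNat = 2 ^ (k + 1) := by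
    have : (2 : ℤ) ^ k - -2 ^ k = ((2 ^ (k + 1) : ℕ) : ℤ) := by push_cast; ring
    rw [this, Int.toNat_natCast]
  rw [this, ← pow_mul, mul_comm]

lemma mem_box_of_lev_le {z : Fin d → ℤ} {i : ℕ} (h : lev z ≤ i) : z ∈ box d (i + 1) := by
  rw [mem_box]
  intro l
  have h1 : ((z l).natAbs : ℤ) < 2 ^ i := by exact_mod_cast lev_le_iff.1 h l
  rw [Nat.add_sub_cancel]
  omega

lemma lev_sub_le_of_mem_box {k : ℕ} (hk : 1 ≤ k) {x y : Fin d → ℤ} (hx : x ∈ box d k)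
    (hy : y ∈ box d k) : lev (x - y) ≤ k := by
  obtain ⟨k, rfl⟩ := Nat.exists_eq_add_of_le' hk
  rw [lev_le_iff]
  intro l
  have h1 := mem_box.1 hx l
  have h2 := mem_box.1 hy l
  rw [Nat.add_sub_cancel] at h1 h2
  have h3 : (2 : ℤ) ^ (k + 1) = 2 * 2 ^ k := by rw [pow_succ]; ring
  have : (((x - y) l).natAbs : ℤ) < 2 ^ (k + 1) := by
    rw [Pi.sub_apply]; omega
  exact_mod_cast this

lemma sum_comp_lev_le (X : Finset (Fin d → ℤ)) {g : ℕ → ℝ} (hg : ∀ a, 0 ≤ g a) :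
    ∃ M, ∑ z ∈ X, g (lev z) ≤ 2 ^ d * ∑ a ∈ Finset.range M, (2 ^ d) ^ a * g a := by
  refine ⟨X.sup lev + 1, ?_⟩
  rw [← Finset.sum_fiberwise_of_maps_to (t := Finset.range (X.sup lev + 1)) (g := lev)
    fun z hz => Finset.mem_range.2 (Nat.lt_succ_of_le (Finset.le_sup hz)), Finset.mul_sum]
  refine Finset.sum_le_sum fun a _ => ?_
  have h1 : ∑ z ∈ X.filter (fun z => lev z = a), g (lev z)
      = ((X.filter fun z => lev z = a).card : ℝ) * g a := by
    rw [Finset.sum_congr rfl fun z hz => by rw [(Finset.mem_filter.1 hz).2], Finset.sum_const,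
      nsmul_eq_mul]
  have h2 : (X.filter fun z => lev z = a).card ≤ 2 ^ (d * (a + 1)) := by
    rw [← card_box]
    exact Finset.card_le_card fun z hz => mem_box_of_lev_le (Finset.mem_filter.1 hz).2.le
  have h3 : ((X.filter fun z => lev z = a).card : ℝ) ≤ 2 ^ d * (2 ^ d) ^ a := by
    calc ((X.filter fun z => lev z = a).card : ℝ) ≤ ((2 ^ (d * (a + 1)) : ℕ) : ℝ) := by
          exact_mod_cast h2
      _ = 2 ^ d * (2 ^ d) ^ a := by push_cast; rw [pow_mul, pow_succ']
  rw [h1, ← mul_assoc]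
  exact mul_le_mul_of_nonneg_right h3 (hg a)

/-- Where `lev z ≤ lev (δ - z)`, the level of `δ - z` is at least `max (lev z) (lev δ) - 1`. Summing
over shells of about `2 ^ (d * a)` points leaves two geometric sums, both dominated by the shell at
level `lev δ`. -/
lemma sum_pow_lev_mul_half_le {p q : ℝ} (hp : 0 < p) (hq : 0 < q) (hq1 : q ≤ 1)
    (hs : 1 < 2 ^ d * p) (ht : 2 ^ d * p * q < 1) (X : Finset (Fin d → ℤ)) (δ : Fin d → ℤ) :
    ∑ z ∈ X.filter (fun z => lev z ≤ lev (δ - z)), p ^ lev z * q ^ lev (δ - z)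
      ≤ q⁻¹ * (2 ^ d * ((2 ^ d * p) / (2 ^ d * p - 1) + 1 / (1 - 2 ^ d * p * q)))
        * (2 ^ d * p * q) ^ lev δ := by
  set L := lev δ with hL
  set s := 2 ^ d * p with hsdef
  set t := s * q with htdef
  have hs0 : 0 < s := by positivity
  have ht0 : 0 < t := by positivity
  have h1 : ∀ z ∈ X.filter (fun z => lev z ≤ lev (δ - z)), p ^ lev z * q ^ lev (δ - z)
      ≤ q⁻¹ * (p ^ lev z * q ^ max (lev z) L) := by
    intro z hz
    have hz := (Finset.mem_filter.1 hz).2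
    have h2 : L ≤ lev (δ - z) + 1 := by
      have := lev_add_le z (δ - z)
      rw [add_sub_cancel, max_eq_right hz] at this
      exact this
    have h3 : q * q ^ lev (δ - z) ≤ q ^ max (lev z) L := by
      rw [← pow_succ']
      exact pow_le_pow_of_le_one hq.le hq1 (by omega)
    have h4 : q ^ lev (δ - z) ≤ q⁻¹ * q ^ max (lev z) L := by
      rw [inv_mul_eq_div, le_div_iff₀ hq, mul_comm]; exact h3
    calc _ ≤ p ^ lev z * (q⁻¹ * q ^ max (lev z) L) :=
          mul_le_mul_of_nonneg_left h4 (by positivity)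
      _ = _ := by ring
  refine (Finset.sum_le_sum h1).trans ?_
  rw [← Finset.mul_sum, mul_assoc]
  refine mul_le_mul_of_nonneg_left ?_ (by positivity)
  obtain ⟨M, hM⟩ := sum_comp_lev_le (X.filter (fun z => lev z ≤ lev (δ - z)))
    (g := fun a => p ^ a * q ^ max a L) (fun a => by positivity)
  refine hM.trans ?_
  rw [mul_assoc]
  refine mul_le_mul_of_nonneg_left ?_ (by positivity)
  have h5 : ∑ a ∈ Finset.range M, ((2 : ℝ) ^ d) ^ a * (p ^ a * q ^ max a L)
      ≤ ∑ a ∈ Finset.range (M + (L + 1)), (2 ^ d) ^ a * (p ^ a * q ^ max a L) :=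
    Finset.sum_le_sum_of_subset_of_nonneg (Finset.range_mono (by omega))
      fun a _ _ => by positivity
  refine h5.trans ?_
  -- Split at `a = L`: below it the ratio is `s > 1`, above it the ratio is `t < 1`.
  rw [Finset.range_eq_Ico, ← Finset.sum_Ico_consecutive _ (Nat.zero_le (L + 1))
    (by omega : L + 1 ≤ M + (L + 1)), add_mul]
  refine add_le_add ?_ ?_
  · have : ∑ a ∈ Finset.Ico 0 (L + 1), ((2 : ℝ) ^ d) ^ a * (p ^ a * q ^ max a L)
        = q ^ L * ∑ a ∈ Finset.range (L + 1), s ^ a := by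
      rw [← Finset.range_eq_Ico, Finset.mul_sum]
      refine Finset.sum_congr rfl fun a ha => ?_
      rw [max_eq_right (by have := Finset.mem_range.1 ha; omega), hsdef, mul_pow]
      ring
    have ht2 : t ^ L = s ^ L * q ^ L := mul_pow s q L
    rw [this, geom_sum_eq hs.ne', ht2, div_mul_eq_mul_div, mul_div_assoc']
    have hs1 : 0 < s - 1 := by linarith
    rw [div_le_div_iff_of_pos_right hs1, pow_succ]
    have : 0 < q ^ L := by positivity
    nlinarith
  · have : ∑ a ∈ Finset.Ico (L + 1) (M + (L + 1)), ((2 : ℝ) ^ d) ^ a * (p ^ a * q ^ max a L)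
        = ∑ a ∈ Finset.Ico (L + 1) (M + (L + 1)), t ^ a := by
      refine Finset.sum_congr rfl fun a ha => ?_
      rw [max_eq_left (by have := Finset.mem_Ico.1 ha; omega), htdef, hsdef, mul_pow, mul_pow]
      ring
    rw [this]
    refine (geom_sum_Ico_le_of_lt_one ht0.le ht).trans ?_
    rw [one_div, inv_mul_eq_div, div_le_div_iff_of_pos_right (by linarith)]
    exact pow_le_pow_of_le_one ht0.le ht.le (by omega)

/-- The convolution estimate for the two height kernels. -/
lemma exists_sum_pow_lev_mul_le {p q : ℝ} (hp : 0 < p) (hp1 : p ≤ 1) (hq : 0 < q) (hq1 : q ≤ 1)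
    (hs : 1 < 2 ^ d * p) (hs' : 1 < 2 ^ d * q) (ht : 2 ^ d * p * q < 1) :
    ∃ C : ℝ, 0 < C ∧ ∀ (X : Finset (Fin d → ℤ)) (δ : Fin d → ℤ),
      ∑ z ∈ X, p ^ lev z * q ^ lev (δ - z) ≤ C * (2 ^ d * p * q) ^ lev δ := by
  have ht' : 2 ^ d * q * p < 1 := by linarith [mul_right_comm (2 ^ d) p q]
  set C₁ := q⁻¹ * (2 ^ d * ((2 ^ d * p) / (2 ^ d * p - 1) + 1 / (1 - 2 ^ d * p * q))) with hC₁
  set C₂ := p⁻¹ * (2 ^ d * ((2 ^ d * q) / (2 ^ d * q - 1) + 1 / (1 - 2 ^ d * q * p))) with hC₂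
  have a1 : 0 < 2 ^ d * p - 1 := by linarith
  have a2 : 0 < 2 ^ d * q - 1 := by linarith
  have a3 : 0 < 1 - 2 ^ d * p * q := by linarith
  have a4 : 0 < 1 - 2 ^ d * q * p := by linarith
  refine ⟨C₁ + C₂, by positivity, fun X δ => ?_⟩
  rw [← Finset.sum_filter_add_sum_filter_not X (fun z => lev z ≤ lev (δ - z)), add_mul]
  refine add_le_add (sum_pow_lev_mul_half_le hp hq hq1 hs ht X δ) ?_
  -- The complementary half is the same estimate with `p` and `q` exchanged, after the reflection `z
  -- ↦ δ - z`.
  have h := sum_pow_lev_mul_half_le hq hp hp1 hs' ht' (X.image fun z => δ - z) δ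
  rw [← hC₂, mul_right_comm (2 ^ d) q p] at h
  refine le_trans ?_ h
  rw [Finset.filter_image, Finset.sum_image fun x _ y _ hxy => by simpa using hxy]
  simp only [sub_sub_cancel]
  rw [Finset.sum_congr rfl fun z _ => mul_comm (p ^ lev z) (q ^ lev (δ - z))]
  refine Finset.sum_le_sum_of_subset_of_nonneg (fun z hz => ?_) fun z _ _ => by positivity
  rw [Finset.mem_filter] at hz ⊢
  exact ⟨hz.1, by omega⟩

/-- The height of the smallest dyadic cube, among those deciding the percolation of depth `m`,
that contains both points. -/
def height (m : ℕ) (x x' : Fin d → ℤ) : ℕ :=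
  m - ((Finset.range m).filter fun i => anc i x = anc i x').card

lemma height_le {m i : ℕ} {x x' : Fin d → ℤ} (h : anc i x = anc i x') : height m x x' ≤ i := by
  have : (Finset.Ico i m).card ≤ ((Finset.range m).filter fun i => anc i x = anc i x').card :=
    Finset.card_le_card fun j hj => by
      rw [Finset.mem_Ico] at hj
      exact Finset.mem_filter.2 ⟨Finset.mem_range.2 hj.2, anc_eq_of_le hj.1 h⟩
  rw [Nat.card_Ico] at this
  rw [height]; omega

lemma lev_sub_le_of_anc_eq {i : ℕ} {x x' : Fin d → ℤ} (h : anc i x = anc i x') :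
    lev (x - x') ≤ i := by
  rw [lev_le_iff]
  intro l
  have h1 := congrFun h l
  simp only [anc] at h1
  have e1 := Int.mul_ediv_add_emod (x l) (2 ^ i)
  have e2 := Int.mul_ediv_add_emod (x' l) (2 ^ i)
  have hB : (0 : ℤ) < 2 ^ i := by positivity
  have b1 := Int.emod_nonneg (x l) hB.ne'
  have b2 := Int.emod_nonneg (x' l) hB.ne'
  have b3 := Int.emod_lt_of_pos (x l) hB
  have b4 := Int.emod_lt_of_pos (x' l) hB
  rw [h1] at e1
  have : (((x - x') l).natAbs : ℤ) < 2 ^ i := by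
    rw [Pi.sub_apply]; omega
  exact_mod_cast this

/-- Points in a common cube are closer than its side. If only the starting cube is common, the
height is `m` and the bound comes from the box. -/
lemma lev_sub_le_height {m : ℕ} (hm : 1 ≤ m) {x x' : Fin d → ℤ} (hx : x ∈ box d m)
    (hx' : x' ∈ box d m) : lev (x - x') ≤ height m x x' := by
  have h1 : ((Finset.range m).filter fun i => anc i x = anc i x').card
      ≤ (Finset.Ico (lev (x - x')) m).card := Finset.card_le_card fun j hj => by
    rw [Finset.mem_filter, Finset.mem_range] at hj
    exact Finset.mem_Ico.2 ⟨lev_sub_le_of_anc_eq hj.2, hj.1⟩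
  rw [Nat.card_Ico] at h1
  have := lev_sub_le_of_mem_box hm hx hx'
  rw [height]; omega

/-- A path of depth `m` shares `m` minus the height coins with another, so the normalisation turns
shared coins into heights. -/
lemma hitKernel_pairPath {p q : ℝ} (hp : 0 < p) (hq : 0 < q) (m n : ℕ)
    (z z' : (Fin d → ℤ) × (Fin d → ℤ)) :
    p ^ m * q ^ n * hitKernel (Sum.elim (fun _ => p) fun _ => q) (pairPath m n) z z'
      = p ^ height m z.1 z'.1 * q ^ height n z.2 z'.2 := by
  have e : pairPath m n z ∩ pairPath m n z'
      = (cellPath m z.1 ∩ cellPath m z'.1).disjSum (cellPath n z.2 ∩ cellPath n z'.2) := by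
    ext c
    rcases c with c | c <;> simp [pairPath]
  have hpow : ∀ {a : ℝ} (_ : 0 < a) (m : ℕ) (x x' : Fin d → ℤ),
      a ^ m = a ^ height m x x' * a ^ (cellPath m x ∩ cellPath m x').card := by
    intro a _ m x x'
    rw [← pow_add, card_cellPath_inter, height, Nat.sub_add_cancel]
    exact (Finset.card_filter_le _ _).trans (Finset.card_range m).le
  rw [hitKernel, e, Finset.prod_disjSum]
  simp only [Sum.elim_inl, Sum.elim_inr, Finset.prod_const]
  rw [hpow hp m z.1 z'.1, hpow hq n z.2 z'.2]
  have h1 : p ^ (cellPath m z.1 ∩ cellPath m z'.1).card ≠ 0 := (pow_pos hp _).ne'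
  have h2 : q ^ (cellPath n z.2 ∩ cellPath n z'.2).card ≠ 0 := (pow_pos hq _).ne'
  field_simp

lemma ediv_add_ediv_le {B : ℤ} (hB : 0 < B) (x y : ℤ) :
    x / B + y / B ≤ (x + y) / B ∧ (x + y) / B ≤ x / B + y / B + 1 := by
  have h1 := Int.ediv_mul_le x hB.ne'
  have h2 := Int.ediv_mul_le y hB.ne'
  have h3 := Int.lt_ediv_add_one_mul_self x hB
  have h4 := Int.lt_ediv_add_one_mul_self y hB
  constructor
  · rw [Int.le_ediv_iff_mul_le hB]; linarith
  · have : (x + y) / B < x / B + y / B + 2 := by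
      rw [Int.ediv_lt_iff_lt_mul hB]; linarith
    omega

lemma ediv_mem_of_lt {B x : ℤ} (h1 : -B ≤ x) (h2 : x < B) : -1 ≤ x / B ∧ x / B ≤ 0 := by
  have hB : 0 < B := by linarith
  constructor
  · rw [Int.le_ediv_iff_mul_le hB]; linarith
  · have : x / B < 1 := by rw [Int.ediv_lt_iff_lt_mul hB]; linarith
    omega

/-- The vectors with all coordinates in `{-1, 0, 1}`. -/
def unitSteps (d : ℕ) : Finset (Fin d → ℤ) := Fintype.piFinset fun _ => Finset.Icc (-1) 1

lemma mem_unitSteps {e : Fin d → ℤ} : e ∈ unitSteps d ↔ ∀ l, -1 ≤ e l ∧ e l ≤ 1 := by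
  simp [unitSteps, Fintype.mem_piFinset]

lemma card_unitSteps : (unitSteps d).card = 3 ^ d := by
  simp [unitSteps, Fintype.card_piFinset]

lemma anc_sub_anc_mem_unitSteps (a a' : Fin d → ℤ) :
    anc (lev (a' - a)) a' - anc (lev (a' - a)) a ∈ unitSteps d := by
  rw [mem_unitSteps]
  intro l
  have hB : (0 : ℤ) < 2 ^ lev (a' - a) := by positivity
  have h : (((a' - a) l).natAbs : ℤ) < 2 ^ lev (a' - a) := by
    exact_mod_cast natAbs_lt_two_pow_lev (a' - a) l
  rw [Pi.sub_apply] at h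
  have h1 := ediv_add_ediv_le hB (a' l - a l) (a l)
  have h2 := ediv_mem_of_lt (B := 2 ^ lev (a' - a)) (x := a' l - a l) (by omega) (by omega)
  rw [sub_add_cancel] at h1
  simp only [anc, Pi.sub_apply]
  omega

end Levels

/-! ### Cauchy–Schwarz for partitions and translations. -/

section Partition

variable {Z V W : Type*} [DecidableEq V] [DecidableEq W]

lemma sum_sum_ite_eq_sum_sq (E : Finset Z) (ν : Z → ℝ) (g : Z → V) :
    ∑ z ∈ E, ∑ z' ∈ E, (if g z = g z' then ν z * ν z' else 0)
      = ∑ v ∈ E.image g, (∑ z ∈ E.filter (fun z => g z = v), ν z) ^ 2 := by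
  rw [← Finset.sum_fiberwise_of_maps_to (t := E.image g) (g := g)
    fun z hz => Finset.mem_image_of_mem g hz]
  refine Finset.sum_congr rfl fun v _ => ?_
  rw [sq, Finset.sum_mul_sum]
  refine Finset.sum_congr rfl fun z hz => ?_
  rw [Finset.sum_filter]
  refine Finset.sum_congr rfl fun z' _ => ?_
  rw [(Finset.mem_filter.1 hz).2]
  simp only [eq_comm]

/-- Cauchy–Schwarz for a partition each class of which meets at most `K` classes of another. -/
lemma sum_sum_ite_eq_le_mul {E : Finset Z} {ν : Z → ℝ} (hν : ∀ z, 0 ≤ ν z) {f : Z → W} {g : Z → V}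
    {K : ℝ} (hK0 : 0 ≤ K)
    (hK : ∀ w, (((E.filter fun z => f z = w).image g).card : ℝ) ≤ K) :
    ∑ z ∈ E, ∑ z' ∈ E, (if f z = f z' then ν z * ν z' else 0)
      ≤ K * ∑ z ∈ E, ∑ z' ∈ E, (if g z = g z' then ν z * ν z' else 0) := by
  have hnn : ∀ z z', 0 ≤ if g z = g z' then ν z * ν z' else 0 := fun z z' => by
    split_ifs
    exacts [mul_nonneg (hν z) (hν z'), le_rfl]
  rw [sum_sum_ite_eq_sum_sq E ν f]
  have h1 : ∀ w, (∑ z ∈ E.filter (fun z => f z = w), ν z) ^ 2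
      ≤ K * ∑ z ∈ E.filter (fun z => f z = w), ∑ z' ∈ E.filter (fun z => f z = w),
        (if g z = g z' then ν z * ν z' else 0) := by
    intro w
    rw [sum_sum_ite_eq_sum_sq, ← Finset.sum_fiberwise_of_maps_to
      (t := (E.filter fun z => f z = w).image g) (g := g)
      fun z hz => Finset.mem_image_of_mem g hz]
    exact sq_sum_le_card_mul_sum_sq.trans
      (mul_le_mul_of_nonneg_right (hK w) (Finset.sum_nonneg fun _ _ => sq_nonneg _))
  refine (Finset.sum_le_sum fun w _ => h1 w).trans ?_
  rw [← Finset.mul_sum]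
  refine mul_le_mul_of_nonneg_left ?_ hK0
  have h2 : ∀ w, ∑ z ∈ E.filter (fun z => f z = w), ∑ z' ∈ E.filter (fun z => f z = w),
        (if g z = g z' then ν z * ν z' else 0)
      ≤ ∑ z ∈ E.filter (fun z => f z = w), ∑ z' ∈ E,
        (if g z = g z' then ν z * ν z' else 0) := fun w =>
    Finset.sum_le_sum fun z _ => Finset.sum_le_sum_of_subset_of_nonneg (Finset.filter_subset _ _)
      fun z' _ _ => hnn z z'
  refine (Finset.sum_le_sum fun w _ => h2 w).trans ?_
  rw [Finset.sum_fiberwise_of_maps_to fun z hz => Finset.mem_image_of_mem f hz]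

/-- An autocorrelation is largest at shift zero: `μ w * μ (w + e)` is at most the mean of the two
squares, and translating does not increase the sum of squares over the support. -/
lemma sum_sum_ite_add_eq_le [AddCommGroup W] {E : Finset Z} {ν : Z → ℝ} (hν : ∀ z, 0 ≤ ν z)
    (f : Z → W) (e : W) :
    ∑ z ∈ E, ∑ z' ∈ E, (if f z' - f z = e then ν z * ν z' else 0)
      ≤ ∑ z ∈ E, ∑ z' ∈ E, (if f z = f z' then ν z * ν z' else 0) := by
  set μ : W → ℝ := fun w => ∑ z ∈ E.filter (fun z => f z = w), ν z with hμ
  have hμ0 : ∀ w, 0 ≤ μ w := fun w => Finset.sum_nonneg fun z _ => hν z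
  have h1 : ∑ z ∈ E, ∑ z' ∈ E, (if f z' - f z = e then ν z * ν z' else 0)
      = ∑ w ∈ E.image f, μ w * μ (w + e) := by
    rw [← Finset.sum_fiberwise_of_maps_to (t := E.image f) (g := f)
      fun z hz => Finset.mem_image_of_mem f hz]
    refine Finset.sum_congr rfl fun w _ => ?_
    simp only [hμ]
    rw [Finset.sum_mul_sum]
    refine Finset.sum_congr rfl fun z hz => ?_
    rw [Finset.sum_filter]
    refine Finset.sum_congr rfl fun z' _ => ?_
    rw [(Finset.mem_filter.1 hz).2]
    simp only [sub_eq_iff_eq_add, add_comm e w]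
  have h2 : ∑ w ∈ E.image f, μ (w + e) ^ 2 ≤ ∑ w ∈ E.image f, μ w ^ 2 := by
    rw [← Finset.sum_filter_of_ne (p := fun w => w + e ∈ E.image f)]
    · rw [← Finset.sum_image (f := fun w => μ w ^ 2) (g := fun w => w + e)
        fun x _ y _ h => by simpa using h]
      refine Finset.sum_le_sum_of_subset_of_nonneg ?_ fun _ _ _ => sq_nonneg _
      intro w hw
      obtain ⟨v, hv, rfl⟩ := Finset.mem_image.1 hw
      exact (Finset.mem_filter.1 hv).2
    · intro w _ hw
      by_contra hcon
      refine hw ?_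
      rw [sq_eq_zero_iff]
      refine Finset.sum_eq_zero fun z hz => absurd ?_ hcon
      rw [Finset.mem_filter] at hz
      exact hz.2 ▸ Finset.mem_image_of_mem f hz.1
  have h3 : ∑ w ∈ E.image f, μ w * μ (w + e)
      ≤ ∑ w ∈ E.image f, (μ w ^ 2 / 2 + μ (w + e) ^ 2 / 2) :=
    Finset.sum_le_sum fun w _ => by nlinarith [sq_nonneg (μ w - μ (w + e))]
  rw [Finset.sum_add_distrib, ← Finset.sum_div, ← Finset.sum_div] at h3
  rw [h1, sum_sum_ite_eq_sum_sq]
  change _ ≤ ∑ w ∈ E.image f, μ w ^ 2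
  linarith

lemma sum_sum_ite_mem_le [AddCommGroup W] {E : Finset Z} {ν : Z → ℝ} (hν : ∀ z, 0 ≤ ν z)
    (f : Z → W) (D : Finset W) :
    ∑ z ∈ E, ∑ z' ∈ E, (if f z' - f z ∈ D then ν z * ν z' else 0)
      ≤ D.card * ∑ z ∈ E, ∑ z' ∈ E, (if f z = f z' then ν z * ν z' else 0) := by
  have h1 : ∀ z z', (if f z' - f z ∈ D then ν z * ν z' else 0)
      = ∑ e ∈ D, if f z' - f z = e then ν z * ν z' else 0 := fun z z' => by
    rw [Finset.sum_ite_eq]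
  have h2 : ∑ z ∈ E, ∑ z' ∈ E, (if f z' - f z ∈ D then ν z * ν z' else 0)
      = ∑ e ∈ D, ∑ z ∈ E, ∑ z' ∈ E, if f z' - f z = e then ν z * ν z' else 0 := by
    simp only [h1]
    rw [Finset.sum_comm]
    rw [Finset.sum_congr rfl fun z' _ => Finset.sum_comm]
    rw [Finset.sum_comm]
    exact Finset.sum_congr rfl fun e _ => Finset.sum_comm
  rw [h2]
  refine (Finset.sum_le_sum fun e _ => sum_sum_ite_add_eq_le hν f e).trans ?_
  rw [Finset.sum_const, nsmul_eq_mul]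

end Partition

/-! ### Comparison of dyadic levels with Euclidean distance and diameter. -/

section Distance

variable {d : ℕ}

lemma abs_sub_le_dist (a b : Fin d → ℤ) (l : Fin d) :
    |((a l : ℝ) - b l)| ≤ dist (toEuc a) (toEuc b) := by
  have := PiLp.dist_apply_le (toEuc a) (toEuc b) l
  simpa [toEuc, Real.dist_eq] using this

lemma two_pow_lev_le (a b : Fin d → ℤ) :
    (2 : ℝ) ^ lev (a - b) ≤ 2 * max (dist (toEuc a) (toEuc b)) 1 := by
  rcases Nat.eq_zero_or_pos (lev (a - b)) with h | h
  · rw [h, pow_zero]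
    linarith [le_max_right (dist (toEuc a) (toEuc b)) 1]
  · obtain ⟨k, hk⟩ := Nat.exists_eq_add_of_le' h
    obtain ⟨l, hl⟩ := exists_two_pow_le (i := k) (z := a - b) (by omega)
    have h1 : (2 : ℝ) ^ k ≤ |((a l : ℝ) - b l)| := by
      have : ((2 ^ k : ℕ) : ℝ) ≤ (((a - b) l).natAbs : ℝ) := by exact_mod_cast hl
      rw [Nat.cast_natAbs] at this
      push_cast [Pi.sub_apply] at this
      exact this
    have h2 := abs_sub_le_dist a b l
    have h3 := le_max_left (dist (toEuc a) (toEuc b)) 1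
    rw [hk, pow_succ]
    linarith

lemma max_dist_le (hd : 1 ≤ d) (a b : Fin d → ℤ) :
    max (dist (toEuc a) (toEuc b)) 1 ≤ d * 2 ^ lev (a - b) := by
  have hd' : (1 : ℝ) ≤ d := by exact_mod_cast hd
  have h1 : (1 : ℝ) ≤ 2 ^ lev (a - b) := one_le_pow₀ (by norm_num)
  refine max_le ?_ (by nlinarith)
  rw [EuclideanSpace.dist_eq]
  refine Real.sqrt_le_iff.2 ⟨by positivity, ?_⟩
  have h2 : ∀ l : Fin d, dist (toEuc a l) (toEuc b l) ^ 2 ≤ ((2 : ℝ) ^ lev (a - b)) ^ 2 := by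
    intro l
    refine pow_le_pow_left₀ dist_nonneg ?_ 2
    have h3 : (((a - b) l).natAbs : ℝ) < 2 ^ lev (a - b) := by
      exact_mod_cast natAbs_lt_two_pow_lev (a - b) l
    rw [Nat.cast_natAbs] at h3
    push_cast [Pi.sub_apply] at h3
    simpa [toEuc, Real.dist_eq] using h3.le
  refine (Finset.sum_le_sum fun l _ => h2 l).trans ?_
  rw [Finset.sum_const, Finset.card_univ, Fintype.card_fin, nsmul_eq_mul, mul_pow]
  exact mul_le_mul_of_nonneg_right (by nlinarith) (by positivity)

lemma two_pow_rpow_neg {t β : ℝ} (ht : 0 < t) (hβ : β = -Real.logb 2 t) (k : ℕ) :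
    ((2 : ℝ) ^ k) ^ (-β) = t ^ k := by
  rw [← Real.rpow_natCast_mul (by norm_num), mul_comm, Real.rpow_mul_natCast (by norm_num), hβ,
    neg_neg, Real.rpow_logb (by norm_num) (by norm_num) ht]

lemma pow_lev_le_rpow (hd : 1 ≤ d) {t β : ℝ} (ht : 0 < t) (hβ : β = -Real.logb 2 t)
    (hβ0 : 0 < β) (a b : Fin d → ℤ) :
    t ^ lev (a - b) ≤ (d : ℝ) ^ β * max (dist (toEuc a) (toEuc b)) 1 ^ (-β) := by
  have hd' : (0 : ℝ) < d := by exact_mod_cast hd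
  have h := Real.rpow_le_rpow_of_nonpos (lt_max_of_lt_right one_pos) (max_dist_le hd a b)
    (neg_nonpos.2 hβ0.le)
  rw [Real.mul_rpow hd'.le (by positivity), two_pow_rpow_neg ht hβ, Real.rpow_neg hd'.le,
    inv_mul_le_iff₀ (Real.rpow_pos_of_pos hd' β)] at h
  exact h

lemma rpow_le_pow_lev {t β : ℝ} (ht : 0 < t) (hβ : β = -Real.logb 2 t)
    (hβ0 : 0 < β) (a b : Fin d → ℤ) :
    max (dist (toEuc a) (toEuc b)) 1 ^ (-β) ≤ 2 ^ β * t ^ lev (a - b) := by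
  have h1 : (2 : ℝ)⁻¹ * 2 ^ lev (a - b) ≤ max (dist (toEuc a) (toEuc b)) 1 := by
    linarith [two_pow_lev_le a b]
  have h := Real.rpow_le_rpow_of_nonpos (by positivity) h1 (neg_nonpos.2 hβ0.le)
  rw [Real.mul_rpow (by norm_num) (by positivity), two_pow_rpow_neg ht hβ,
    Real.inv_rpow (by norm_num), Real.rpow_neg zero_le_two, inv_inv] at h
  exact h

/-- A positive level forces the diameter to be at least one, which keeps the logarithm away from its
default value at zero. -/
lemma lev_sub_sub_one_le_logb_diam {A : Finset (Fin d → ℤ)} {a b : Fin d → ℤ} (ha : a ∈ A)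
    (hb : b ∈ A) (h : 1 ≤ lev (a - b)) : (lev (a - b) : ℝ) - 1 ≤ Real.logb 2 (diam A) := by
  obtain ⟨k, hk⟩ := Nat.exists_eq_add_of_le' h
  obtain ⟨l, hl⟩ := exists_two_pow_le (i := k) (z := a - b) (by omega)
  have h1 : (2 : ℝ) ^ k ≤ |((a l : ℝ) - b l)| := by
    have : ((2 ^ k : ℕ) : ℝ) ≤ (((a - b) l).natAbs : ℝ) := by exact_mod_cast hl
    rw [Nat.cast_natAbs] at this
    push_cast [Pi.sub_apply] at this
    exact this
  have h2 : dist (toEuc a) (toEuc b) ≤ diam A :=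
    Metric.dist_le_diam_of_mem (A.finite_toSet.image toEuc).isBounded
      (Set.mem_image_of_mem _ ha) (Set.mem_image_of_mem _ hb)
  have h3 : (2 : ℝ) ^ k ≤ diam A := h1.trans ((abs_sub_le_dist a b l).trans h2)
  rw [hk]
  push_cast
  rw [add_sub_cancel_right, Real.le_logb_iff_rpow_le (by norm_num)
    (lt_of_lt_of_le (by positivity) h3), Real.rpow_natCast]
  exact h3

end Distance

/-! ### Lower bound: the second moment method with uniformly spread atoms. -/

section Capacity

variable {d : ℕ}

lemma cellPath_subset_boxCoins {m : ℕ} {x : Fin d → ℤ} (hx : x ∈ box d m) :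
    cellPath m x ⊆ boxCoins d m :=
  fun _ hc => Finset.mem_biUnion.2 ⟨x, hx, hc⟩

lemma mem_pairsInto {m n : ℕ} {A : Finset (Fin d → ℤ)} {z : (Fin d → ℤ) × (Fin d → ℤ)} :
    z ∈ pairsInto m n A ↔ (z.1 ∈ box d m ∧ z.2 ∈ box d n) ∧ z.1 + z.2 ∈ A := by
  simp [pairsInto]

lemma pairPath_subset {m n : ℕ} {A : Finset (Fin d → ℤ)} {z : (Fin d → ℤ) × (Fin d → ℤ)}
    (hz : z ∈ pairsInto m n A) : pairPath m n z ⊆ (boxCoins d m).disjSum (boxCoins d n) :=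
  Finset.disjSum_mono (cellPath_subset_boxCoins (mem_pairsInto.1 hz).1.1)
    (cellPath_subset_boxCoins (mem_pairsInto.1 hz).1.2)

/-- An orthant of the box of side `2 ^ m`, chosen such that `a - x` remains in any larger box
containing `a`. -/
def orthant (m : ℕ) (a : Fin d → ℤ) : Finset (Fin d → ℤ) :=
  Fintype.piFinset fun l =>
    if 0 ≤ a l then Finset.Ico 0 (2 ^ (m - 1)) else Finset.Ico (-2 ^ (m - 1)) 0

lemma card_orthant (m : ℕ) (a : Fin d → ℤ) : (orthant m a).card = (2 ^ (m - 1)) ^ d := by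
  rw [orthant, Fintype.card_piFinset]
  have : ∀ l : Fin d, (if 0 ≤ a l then Finset.Ico 0 (2 ^ (m - 1))
      else Finset.Ico (-(2 : ℤ) ^ (m - 1)) 0).card = 2 ^ (m - 1) := by
    intro l
    have : ((2 : ℤ) ^ (m - 1)).toNat = 2 ^ (m - 1) := by
      have : (2 : ℤ) ^ (m - 1) = ((2 ^ (m - 1) : ℕ) : ℤ) := by push_cast; rfl
      rw [this, Int.toNat_natCast]
    split_ifs <;> simp [this]
  simp [this]

lemma mem_box_of_mem_orthant {m n : ℕ} (hmn : m ≤ n) {a x : Fin d → ℤ} (ha : a ∈ box d n)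
    (hx : x ∈ orthant m a) : x ∈ box d m ∧ a - x ∈ box d n := by
  rw [mem_box] at ha
  rw [orthant, Fintype.mem_piFinset] at hx
  have h2 : (2 : ℤ) ^ (m - 1) ≤ 2 ^ (n - 1) := pow_le_pow_right₀ (by norm_num) (by omega)
  have h0 : (0 : ℤ) < 2 ^ (m - 1) := by positivity
  rw [mem_box, mem_box, ← forall_and]
  intro l
  have h1 := ha l
  have h3 := hx l
  rw [Pi.sub_apply]
  split_ifs at h3 <;> rw [Finset.mem_Ico] at h3 <;> constructor <;> constructor <;> omega

lemma sum_pairsInto_orthant {m n : ℕ} (hmn : m ≤ n) {A : Finset (Fin d → ℤ)} (hA : A ⊆ box d n)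
    (F : (Fin d → ℤ) × (Fin d → ℤ) → ℝ) :
    ∑ z ∈ pairsInto m n A, (if z.1 ∈ orthant m (z.1 + z.2) then F z else 0)
      = ∑ a ∈ A, ∑ x ∈ orthant m a, F (x, a - x) := by
  rw [← Finset.sum_filter, Finset.sum_sigma']
  refine Finset.sum_bij' (fun z _ => (⟨z.1 + z.2, z.1⟩ : (_ : Fin d → ℤ) × (Fin d → ℤ)))
    (fun s _ => (s.2, s.1 - s.2)) ?_ ?_ ?_ ?_ ?_
  · intro z hz
    rw [Finset.mem_filter, mem_pairsInto] at hz
    exact Finset.mem_sigma.2 ⟨hz.1.2, hz.2⟩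
  · intro s hs
    rw [Finset.mem_sigma] at hs
    rw [Finset.mem_filter, mem_pairsInto]
    simp only [add_sub_cancel]
    exact ⟨⟨mem_box_of_mem_orthant hmn (hA hs.1) hs.2, hs.1⟩, hs.2⟩
  · intro z _; simp
  · intro s _; simp
  · intro z _; simp

/-- The second moment lower bound, in terms of the Newtonian energy. -/
lemma exists_le_hitProb_mul_energy (hd : 1 ≤ d) {p q β : ℝ} (hp : 0 < p) (hp1 : p ≤ 1)
    (hq : 0 < q) (hq1 : q ≤ 1) (hs : 1 < 2 ^ d * p) (hs' : 1 < 2 ^ d * q)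
    (ht : 2 ^ d * p * q < 1) (hβ : β = -Real.logb 2 (2 ^ d * p * q)) (hβ0 : 0 < β) :
    ∃ c : ℝ, 0 < c ∧ ∀ m n : ℕ, 1 ≤ m → m ≤ n → ∀ A : Finset (Fin d → ℤ), A ⊆ box d n →
      ∀ w ∈ probWeights A, c * (2 ^ d * p) ^ m * q ^ n ≤
        hitProb (Sum.elim (fun _ => p) fun _ => q) ((boxCoins d m).disjSum (boxCoins d n))
          (pairPath m n) (pairsInto m n A) * energy β A w := by
  obtain ⟨C, hC, hconv⟩ := exists_sum_pow_lev_mul_le hp hp1 hq hq1 hs hs' ht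
  have ht0 : 0 < 2 ^ d * p * q := by positivity
  have hdβ : (0 : ℝ) < (d : ℝ) ^ β := Real.rpow_pos_of_pos (by exact_mod_cast hd) β
  refine ⟨(2 ^ d * C * d ^ β)⁻¹, by positivity, fun m n hm hmn A hA w hw => ?_⟩
  set pr : (ℕ × (Fin d → ℤ)) ⊕ (ℕ × (Fin d → ℤ)) → ℝ := Sum.elim (fun _ => p) fun _ => q
  set K : ℝ := (((2 ^ (m - 1)) ^ d : ℕ) : ℝ) with hK
  have hK0 : 0 < K := by rw [hK]; positivity
  -- The mass `w a` is spread uniformly over the `K` pairs `(x, a - x)` with `x` in the orthant of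
  -- `a`; the sign choice keeps `a - x` in `box d n`.
  set ν : (Fin d → ℤ) × (Fin d → ℤ) → ℝ := fun z =>
    if z.1 ∈ orthant m (z.1 + z.2) then w (z.1 + z.2) / K else 0 with hν
  have hpr0 : ∀ c, 0 < pr c := by rintro (c | c) <;> simpa [pr]
  have hpr1 : ∀ c, pr c ≤ 1 := by rintro (c | c) <;> simpa [pr]
  have hν1 : ∑ z ∈ pairsInto m n A, ν z = 1 := by
    simp only [hν]
    rw [sum_pairsInto_orthant hmn hA fun z => w (z.1 + z.2) / K, ← hw.2]
    refine Finset.sum_congr rfl fun a _ => ?_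
    simp only [add_sub_cancel]
    rw [Finset.sum_const, card_orthant, nsmul_eq_mul, ← hK, mul_div_cancel₀ _ hK0.ne']
  have h1 := one_le_hitProb_mul_hitEnergy hpr0 hpr1
    (S := (boxCoins d m).disjSum (boxCoins d n)) (path := pairPath m n)
    (E := pairsInto m n A) (fun z hz => pairPath_subset hz) hν1
  have hen : p ^ m * q ^ n * hitEnergy pr (pairPath m n) (pairsInto m n A) ν
      ≤ K⁻¹ * C * d ^ β * energy β A w := by
    have e1 : p ^ m * q ^ n * hitEnergy pr (pairPath m n) (pairsInto m n A) ν
        = ∑ a ∈ A, ∑ a' ∈ A, ∑ x ∈ orthant m a, ∑ x' ∈ orthant m a',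
          w a / K * (w a' / K) * (p ^ height m x x' * q ^ height n (a - x) (a' - x')) := by
      have e2 : ∀ z ∈ pairsInto m n A, p ^ m * q ^ n * ∑ z' ∈ pairsInto m n A,
          ν z * ν z' * hitKernel pr (pairPath m n) z z'
          = if z.1 ∈ orthant m (z.1 + z.2) then ∑ a' ∈ A, ∑ x' ∈ orthant m a',
            w (z.1 + z.2) / K * (w a' / K)
              * (p ^ height m z.1 x' * q ^ height n z.2 (a' - x')) else 0 := by
        intro z _
        split_ifs with hz
        · have := sum_pairsInto_orthant hmn hA (fun z' => w (z.1 + z.2) / K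
            * (w (z'.1 + z'.2) / K) * (p ^ height m z.1 z'.1 * q ^ height n z.2 z'.2))
          simp only [add_sub_cancel] at this
          rw [← this, Finset.mul_sum]
          refine Finset.sum_congr rfl fun z' _ => ?_
          simp only [hν, if_pos hz]
          rw [mul_left_comm, hitKernel_pairPath hp hq]
          split_ifs <;> ring
        · simp [hν, if_neg hz]
      rw [hitEnergy, Finset.mul_sum, Finset.sum_congr rfl e2,
        sum_pairsInto_orthant hmn hA fun z => ∑ a' ∈ A, ∑ x' ∈ orthant m a',
            w (z.1 + z.2) / K * (w a' / K)
              * (p ^ height m z.1 x' * q ^ height n z.2 (a' - x'))]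
      simp only [add_sub_cancel]
      exact Finset.sum_congr rfl fun a _ => Finset.sum_comm
    rw [e1, energy, Finset.mul_sum]
    refine Finset.sum_le_sum fun a ha => ?_
    rw [Finset.mul_sum]
    refine Finset.sum_le_sum fun a' ha' => ?_
    have hw2 : 0 ≤ w a / K * (w a' / K) :=
      mul_nonneg (div_nonneg (hw.1 a ha) hK0.le) (div_nonneg (hw.1 a' ha') hK0.le)
    have h2 : ∀ x ∈ orthant m a, ∑ x' ∈ orthant m a',
        w a / K * (w a' / K) * (p ^ height m x x' * q ^ height n (a - x) (a' - x'))
        ≤ w a / K * (w a' / K) * (C * (2 ^ d * p * q) ^ lev (a - a')) := by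
      intro x hx
      rw [← Finset.mul_sum]
      refine mul_le_mul_of_nonneg_left ?_ hw2
      -- For fixed `x`, heights are bounded below by levels, and with `z = x - x'` the sum over `x'`
      -- becomes a convolution at `δ = a - a'`.
      have h3 := hconv ((orthant m a').image fun x' => x - x') (a - a')
      rw [Finset.sum_image fun u _ v _ h => by simpa using h] at h3
      refine le_trans (Finset.sum_le_sum fun x' hx' => ?_) h3
      obtain ⟨b1, b2⟩ := mem_box_of_mem_orthant hmn (hA ha) hx
      obtain ⟨b3, b4⟩ := mem_box_of_mem_orthant hmn (hA ha') hx'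
      have l1 := lev_sub_le_height hm b1 b3
      have l2 := lev_sub_le_height (hm.trans hmn) b2 b4
      have e : a - x - (a' - x') = a - a' - (x - x') := by abel
      rw [e] at l2
      exact mul_le_mul (pow_le_pow_of_le_one hp.le hp1 l1) (pow_le_pow_of_le_one hq.le hq1 l2)
        (by positivity) (by positivity)
    refine (Finset.sum_le_sum h2).trans ?_
    rw [Finset.sum_const, card_orthant, nsmul_eq_mul, ← hK]
    have h4 := pow_lev_le_rpow hd ht0 hβ hβ0 a a'
    have h5 : K * (w a / K * (w a' / K) * (C * (2 ^ d * p * q) ^ lev (a - a')))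
        ≤ K * (w a / K * (w a' / K) * (C * ((d : ℝ) ^ β
          * max (dist (toEuc a) (toEuc a')) 1 ^ (-β)))) := by gcongr
    refine h5.trans (le_of_eq ?_)
    field_simp
  set E := hitEnergy pr (pairPath m n) (pairsInto m n A) ν
  set π := hitProb pr ((boxCoins d m).disjSum (boxCoins d n)) (pairPath m n) (pairsInto m n A)
    with hπ
  have hπ0 : 0 ≤ π := by
    rw [hπ, hitProb]
    exact Finset.sum_nonneg fun T _ => mul_nonneg
      (coinWeight_nonneg (fun c => (hpr0 c).le) hpr1 _ T) (by dsimp only; split_ifs <;> norm_num)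
  have h2K : 2 ^ d * K = (2 ^ d) ^ m := by
    obtain ⟨k, rfl⟩ := Nat.exists_eq_add_of_le' hm
    rw [hK, Nat.add_sub_cancel]
    push_cast
    rw [← mul_pow, ← pow_succ', ← pow_mul, ← pow_mul, mul_comm]
  have h6 : p ^ m * q ^ n ≤ π * (K⁻¹ * C * d ^ β * energy β A w) := by
    calc p ^ m * q ^ n ≤ p ^ m * q ^ n * (π * E) := le_mul_of_one_le_right (by positivity) h1
      _ = π * (p ^ m * q ^ n * E) := by ring
      _ ≤ _ := mul_le_mul_of_nonneg_left hen hπ0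
  have h7 := mul_le_mul_of_nonneg_left h6 (by positivity : 0 ≤ (C * d ^ β)⁻¹ * K)
  rw [mul_pow, ← h2K]
  have e8 : (2 ^ d * C * (d : ℝ) ^ β)⁻¹ * (2 ^ d * K * p ^ m) * q ^ n
      = (C * d ^ β)⁻¹ * K * (p ^ m * q ^ n) := by field_simp
  have e9 : (C * (d : ℝ) ^ β)⁻¹ * K * (π * (K⁻¹ * C * d ^ β * energy β A w))
      = π * energy β A w := by field_simp
  rw [e8, ← e9]
  exact h7

end Capacity

/-! ### Upper bound: comparing energies scale by scale under addition. -/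

section UpperBound

variable {d : ℕ}

lemma anc_mem_box {m j : ℕ} (hj : j ≤ m) {x : Fin d → ℤ} (hx : x ∈ box d m) :
    anc j x ∈ box d (m - j + 1) := by
  rw [mem_box] at hx ⊢
  intro l
  have hB : (0 : ℤ) < 2 ^ j := by positivity
  have h1 := hx l
  have h2 : (2 : ℤ) ^ (m - 1) ≤ 2 ^ m := pow_le_pow_right₀ (by norm_num) (by omega)
  have h3 : (2 : ℤ) ^ (m - j) * 2 ^ j = 2 ^ m := by rw [← pow_add, Nat.sub_add_cancel hj]
  rw [Nat.add_sub_cancel]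
  simp only [anc]
  rw [Int.le_ediv_iff_mul_le hB, Int.ediv_lt_iff_lt_mul hB, neg_mul, h3]
  omega

/-- Few pairs of dyadic cubes have a sum meeting a given dyadic cube. -/
lemma card_image_anc_le {m n : ℕ} (hm : 1 ≤ m) (A : Finset (Fin d → ℤ)) (i : ℕ)
    (w : Fin d → ℤ) :
    (((pairsInto m n A).filter fun z => anc i (z.1 + z.2) = w).image
      fun z => (anc (min i m) z.1, anc i z.2)).card ≤ 2 ^ (d * (m - min i m + 1)) * 3 ^ d := by
  rw [← card_box, ← card_unitSteps, ← Finset.card_product]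
  -- A pair of cubes is recovered from the first cube and a remainder in `unitSteps`. For `i ≤ m`
  -- the remainder is the carry of the addition; for `i > m` it also contains the index of the first
  -- summand at height `i`, which is `-1` or `0` in each coordinate.
  refine le_trans (Finset.card_le_card ?_) (Finset.card_image_le
    (f := fun x : (Fin d → ℤ) × (Fin d → ℤ) => (x.1, w - x.2 - if i ≤ m then x.1 else 0)))
  intro c hc
  obtain ⟨z, hz, rfl⟩ := Finset.mem_image.1 hc
  rw [Finset.mem_filter, mem_pairsInto] at hz
  obtain ⟨⟨⟨hx, -⟩, -⟩, rfl⟩ := hz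
  refine Finset.mem_image.2 ⟨(anc (min i m) z.1, anc i (z.1 + z.2) - anc i z.2
    - if i ≤ m then anc (min i m) z.1 else 0), Finset.mem_product.2
      ⟨anc_mem_box (min_le_right _ _) hx, ?_⟩, ?_⟩
  · rw [mem_unitSteps]
    intro l
    have hB : (0 : ℤ) < 2 ^ i := by positivity
    have h1 := ediv_add_ediv_le hB (z.1 l) (z.2 l)
    split_ifs with h
    · rw [min_eq_left h]
      simp only [anc, Pi.sub_apply, Pi.add_apply]
      omega
    · have h2 := mem_box.1 hx l
      have h3 : (2 : ℤ) ^ (m - 1) ≤ 2 ^ i := pow_le_pow_right₀ (by norm_num) (by omega)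
      have h4 := ediv_mem_of_lt (B := 2 ^ i) (x := z.1 l) (by omega) (by omega)
      simp only [anc, Pi.sub_apply, Pi.add_apply, Pi.zero_apply]
      omega
  · simp only [Prod.mk.injEq, true_and]
    abel

/-- Only scales above both heights contribute (with `i` capped at `m` for the first), so the sum is
a geometric tail in `q` starting at the second height. -/
lemma sum_pow_ite_anc_le {p q : ℝ} (hp : 0 < p) (hp1 : p ≤ 1) (hq : 0 < q) (hq1 : q < 1)
    (m n k : ℕ) (z z' : (Fin d → ℤ) × (Fin d → ℤ)) :
    ∑ i ∈ Finset.range k, (if (anc (min i m) z.1, anc i z.2) = (anc (min i m) z'.1, anc i z'.2)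
        then p ^ min i m * q ^ i else 0)
      ≤ (1 - q)⁻¹ * (p ^ height m z.1 z'.1 * q ^ height n z.2 z'.2) := by
  rw [← Finset.sum_filter]
  set h := height m z.1 z'.1
  set h' := height n z.2 z'.2
  have h1 : ∀ i ∈ (Finset.range k).filter (fun i =>
      (anc (min i m) z.1, anc i z.2) = (anc (min i m) z'.1, anc i z'.2)),
      p ^ min i m * q ^ i ≤ p ^ h * q ^ i := by
    intro i hi
    have := (Prod.mk.inj (Finset.mem_filter.1 hi).2).1
    exact mul_le_mul_of_nonneg_right (pow_le_pow_of_le_one hp.le hp1 (height_le this))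
      (by positivity)
  refine (Finset.sum_le_sum h1).trans ?_
  rw [← Finset.mul_sum]
  have h2 : ∑ i ∈ (Finset.range k).filter (fun i =>
      (anc (min i m) z.1, anc i z.2) = (anc (min i m) z'.1, anc i z'.2)), q ^ i
      ≤ ∑ i ∈ Finset.Ico h' k, q ^ i := by
    refine Finset.sum_le_sum_of_subset_of_nonneg (fun i hi => ?_) fun i _ _ => by positivity
    rw [Finset.mem_filter, Finset.mem_range] at hi
    exact Finset.mem_Ico.2 ⟨height_le (Prod.mk.inj hi.2).2, hi.1⟩
  have h3 := h2.trans (geom_sum_Ico_le_of_lt_one hq.le hq1)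
  calc _ ≤ p ^ h * (q ^ h' / (1 - q)) := mul_le_mul_of_nonneg_left h3 (by positivity)
    _ = _ := by rw [div_eq_inv_mul]; ring

/-- The balance of scales. For `i ≤ m` the count of cubes turns `t ^ i` into `(2 ^ d * p) ^ m * (p ^
m)⁻¹ * p ^ i * q ^ i`, up to constants. For larger `i` the count is bounded and the loss is `(2 ^ d
* p) ^ i`, whence the exponent `M`. -/
lemma pow_mul_count_le {p q : ℝ} (hp : 0 < p) (hq : 0 < q) (hs : 1 < 2 ^ d * p) {m M i : ℕ}
    (hm : m ≤ M) (hi : i ≤ M) :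
    (2 ^ d * p * q) ^ i * (2 ^ (d * (m - min i m + 1)) * 3 ^ d)
      ≤ 6 ^ d * ((2 ^ d * p) ^ M * (p ^ m)⁻¹) * (p ^ min i m * q ^ i) := by
  have e6 : (6 : ℝ) ^ d = 2 ^ d * 3 ^ d := by rw [← mul_pow]; norm_num
  have e2 : (2 : ℝ) ^ (d * (m - min i m + 1)) = 2 ^ d * (2 ^ d) ^ (m - min i m) := by
    rw [pow_mul, pow_succ']
  have key : (2 ^ d * p * q) ^ i * (2 ^ d) ^ (m - min i m) * p ^ m
      ≤ (2 ^ d * p) ^ M * (p ^ min i m * q ^ i) := by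
    rcases le_total i m with h | h
    · rw [min_eq_left h]
      have : (2 ^ d * p * q) ^ i * (2 ^ d) ^ (m - i) * p ^ m
          = (2 ^ d * p) ^ m * (p ^ i * q ^ i) := by
        have e : ((2 : ℝ) ^ d) ^ m = (2 ^ d) ^ i * (2 ^ d) ^ (m - i) := by
          rw [← pow_add, Nat.add_sub_cancel' h]
        rw [mul_pow, mul_pow, mul_pow, e]; ring
      rw [this]
      exact mul_le_mul_of_nonneg_right (pow_le_pow_right₀ hs.le hm) (by positivity)
    · rw [min_eq_right h, Nat.sub_self, pow_zero, mul_one, mul_pow, mul_assoc, mul_comm (q ^ i)]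
      exact mul_le_mul_of_nonneg_right (pow_le_pow_right₀ hs.le hi) (by positivity)
  have hpm : 0 < p ^ m := by positivity
  rw [e6, e2]
  calc (2 ^ d * p * q) ^ i * (2 ^ d * (2 ^ d) ^ (m - min i m) * 3 ^ d)
      = 2 ^ d * 3 ^ d * (p ^ m)⁻¹ * ((2 ^ d * p * q) ^ i * (2 ^ d) ^ (m - min i m) * p ^ m) := by
        field_simp
    _ ≤ 2 ^ d * 3 ^ d * (p ^ m)⁻¹ * ((2 ^ d * p) ^ M * (p ^ min i m * q ^ i)) :=
        mul_le_mul_of_nonneg_left key (by positivity)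
    _ = _ := by ring

/-- The energy comparison: a measure on pairs of points has a correlation energy at least a
multiple of the energy of its image under addition. -/
lemma sum_pow_lev_le_hitEnergy {p q : ℝ} (hp : 0 < p) (hp1 : p ≤ 1) (hq : 0 < q) (hq1 : q < 1)
    (hs : 1 < 2 ^ d * p) {m n M : ℕ} (hm : 1 ≤ m) (hmM : m ≤ M) {A : Finset (Fin d → ℤ)}
    (hM : ∀ a ∈ A, ∀ a' ∈ A, lev (a' - a) ≤ M) {ν : (Fin d → ℤ) × (Fin d → ℤ) → ℝ}
    (hν : ∀ z, 0 ≤ ν z) :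
    ∑ z ∈ pairsInto m n A, ∑ z' ∈ pairsInto m n A,
        ν z * ν z' * (2 ^ d * p * q) ^ lev (z'.1 + z'.2 - (z.1 + z.2))
      ≤ 18 ^ d * (1 - q)⁻¹ * (2 ^ d * p) ^ M * q ^ n
        * hitEnergy (Sum.elim (fun _ => p) fun _ => q) (pairPath m n) (pairsInto m n A) ν := by
  set E := pairsInto m n A
  set t := 2 ^ d * p * q with ht
  have ht0 : 0 < t := by positivity
  set g : ℕ → (Fin d → ℤ) × (Fin d → ℤ) → (Fin d → ℤ) × (Fin d → ℤ) :=
    fun i z => (anc (min i m) z.1, anc i z.2) with hg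
  -- Only the term `i = lev` is needed: at that scale the two sums lie in equal or adjacent cubes.
  have h1 : ∀ z ∈ E, ∀ z' ∈ E, ν z * ν z' * t ^ lev (z'.1 + z'.2 - (z.1 + z.2))
      ≤ ∑ i ∈ Finset.range (M + 1), t ^ i *
        if anc i (z'.1 + z'.2) - anc i (z.1 + z.2) ∈ unitSteps d then ν z * ν z' else 0 := by
    intro z hz z' hz'
    have hl := hM _ (mem_pairsInto.1 hz).2 _ (mem_pairsInto.1 hz').2
    refine le_trans (le_of_eq ?_) (Finset.single_le_sum (fun i _ => ?_)
      (Finset.mem_range.2 (Nat.lt_succ_of_le hl)))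
    · rw [if_pos (anc_sub_anc_mem_unitSteps _ _), mul_comm]
    · have := mul_nonneg (hν z) (hν z')
      split_ifs <;> positivity
  -- Adjacent cubes are reduced to equal ones at cost `3 ^ d`, and equal cubes of the sum to equal
  -- pairs of cubes at the cost of the count; hence `18 ^ d = 3 ^ d * 6 ^ d`.
  have h2 : ∀ i ∈ Finset.range (M + 1), t ^ i * ∑ z ∈ E, ∑ z' ∈ E,
        (if anc i (z'.1 + z'.2) - anc i (z.1 + z.2) ∈ unitSteps d then ν z * ν z' else 0)
      ≤ 18 ^ d * ((2 ^ d * p) ^ M * (p ^ m)⁻¹) * ((p ^ min i m * q ^ i) *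
        ∑ z ∈ E, ∑ z' ∈ E, if g i z = g i z' then ν z * ν z' else 0) := by
    intro i hi
    have hi : i ≤ M := Nat.lt_succ_iff.1 (Finset.mem_range.1 hi)
    have a1 := sum_sum_ite_mem_le (E := E) hν (fun z => anc i (z.1 + z.2)) (unitSteps d)
    have a2 := sum_sum_ite_eq_le_mul (E := E) hν (f := fun z => anc i (z.1 + z.2)) (g := g i)
      (K := 2 ^ (d * (m - min i m + 1)) * 3 ^ d) (by positivity)
      (fun w => by exact_mod_cast card_image_anc_le hm A i w)
    have a3 := pow_mul_count_le (q := q) hp hq hs hmM hi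
    set G := ∑ z ∈ E, ∑ z' ∈ E, if g i z = g i z' then ν z * ν z' else 0
    have hG : 0 ≤ G := Finset.sum_nonneg fun z _ => Finset.sum_nonneg fun z' _ => by
      split_ifs
      exacts [mul_nonneg (hν z) (hν z'), le_rfl]
    rw [card_unitSteps] at a1
    push_cast at a1
    have e18 : (18 : ℝ) ^ d = 3 ^ d * 6 ^ d := by rw [← mul_pow]; norm_num
    calc _ ≤ t ^ i * (3 ^ d * ((2 ^ (d * (m - min i m + 1)) * 3 ^ d) * G)) :=
          mul_le_mul_of_nonneg_left
            (a1.trans (mul_le_mul_of_nonneg_left a2 (by positivity))) (by positivity)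
      _ = 3 ^ d * (t ^ i * (2 ^ (d * (m - min i m + 1)) * 3 ^ d)) * G := by ring
      _ ≤ 3 ^ d * (6 ^ d * ((2 ^ d * p) ^ M * (p ^ m)⁻¹) * (p ^ min i m * q ^ i)) * G :=
          mul_le_mul_of_nonneg_right (mul_le_mul_of_nonneg_left a3 (by positivity)) hG
      _ = _ := by rw [e18]; ring
  have h3 : ∑ i ∈ Finset.range (M + 1), ((p ^ min i m * q ^ i) *
        ∑ z ∈ E, ∑ z' ∈ E, if g i z = g i z' then ν z * ν z' else 0)
      ≤ (1 - q)⁻¹ * (p ^ m * q ^ n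
        * hitEnergy (Sum.elim (fun _ => p) fun _ => q) (pairPath m n) E ν) := by
    simp only [Finset.mul_sum, hitEnergy]
    rw [Finset.sum_comm]
    refine Finset.sum_le_sum fun z _ => ?_
    rw [Finset.sum_comm]
    refine Finset.sum_le_sum fun z' _ => ?_
    have b := mul_le_mul_of_nonneg_left (sum_pow_ite_anc_le hp hp1 hq hq1 m n (M + 1) z z')
      (mul_nonneg (hν z) (hν z'))
    rw [← hitKernel_pairPath hp hq, Finset.mul_sum] at b
    refine le_trans (le_of_eq (Finset.sum_congr rfl fun i _ => ?_)) (b.trans (le_of_eq ?_))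
    · simp only [hg]; split_ifs <;> ring
    · ring
  calc _ ≤ ∑ z ∈ E, ∑ z' ∈ E, ∑ i ∈ Finset.range (M + 1), t ^ i *
        (if anc i (z'.1 + z'.2) - anc i (z.1 + z.2) ∈ unitSteps d then ν z * ν z' else 0) :=
        Finset.sum_le_sum fun z hz => Finset.sum_le_sum fun z' hz' => h1 z hz z' hz'
    _ = ∑ i ∈ Finset.range (M + 1), t ^ i * ∑ z ∈ E, ∑ z' ∈ E,
        (if anc i (z'.1 + z'.2) - anc i (z.1 + z.2) ∈ unitSteps d then ν z * ν z' else 0) := by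
        simp only [Finset.mul_sum]
        rw [Finset.sum_congr rfl fun z _ => Finset.sum_comm, Finset.sum_comm]
    _ ≤ _ := Finset.sum_le_sum h2
    _ ≤ 18 ^ d * ((2 ^ d * p) ^ M * (p ^ m)⁻¹) * ((1 - q)⁻¹ * (p ^ m * q ^ n
        * hitEnergy (Sum.elim (fun _ => p) fun _ => q) (pairPath m n) E ν)) := by
        rw [← Finset.mul_sum]
        exact mul_le_mul_of_nonneg_left h3 (by positivity)
    _ = _ := by
        have hpm : p ^ m ≠ 0 := by positivity
        have hq' : 1 - q ≠ 0 := by linarith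
        field_simp

lemma IsPlanarRank.map {N N' Y Z : Type*} [DecidableEq N] [DecidableEq N'] {X : Finset Y}
    {E : Finset Z} {path : Y → Finset N} {r : Y → ℕ} (h : IsPlanarRank X path r) (φ : Z → Y)
    (hφ : ∀ z ∈ E, φ z ∈ X) (ι : N ↪ N') :
    IsPlanarRank E (fun z => (path (φ z)).map ι) (fun z => r (φ z)) := by
  intro w hw z hz z' hz' h1 h2
  rw [← Finset.map_inter, Finset.map_subset_map]
  exact h _ (hφ w hw) _ (hφ z hz) _ (hφ z' hz') h1 h2

/-- The capacity upper bound, in terms of the Newtonian energy. -/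
lemma exists_hitProb_mul_energy_le {p q β : ℝ} (hp : 0 < p) (hp1 : p ≤ 1)
    (hq : 0 < q) (hq1 : q < 1) (hs : 1 < 2 ^ d * p)
    (hβ : β = -Real.logb 2 (2 ^ d * p * q)) (hβ0 : 0 < β) :
    ∃ C : ℝ, 0 < C ∧ ∀ m n : ℕ, 1 ≤ m → ∀ A : Finset (Fin d → ℤ),
      0 < hitProb (Sum.elim (fun _ => p) fun _ => q) ((boxCoins d m).disjSum (boxCoins d n))
          (pairPath m n) (pairsInto m n A) →
      ∃ w ∈ probWeights A,
        hitProb (Sum.elim (fun _ => p) fun _ => q) ((boxCoins d m).disjSum (boxCoins d n))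
          (pairPath m n) (pairsInto m n A) * energy β A w
          ≤ C * (2 ^ d * p) ^ (max (m : ℝ) (Real.logb 2 (diam A))) * q ^ n := by
  have ht0 : 0 < 2 ^ d * p * q := by positivity
  have hq1' : 0 < 1 - q := by linarith
  refine ⟨2 ^ β * (18 ^ d * (1 - q)⁻¹) * 256 * (2 ^ d * p), by positivity,
    fun m n hm A hpos => ?_⟩
  set pr : (ℕ × (Fin d → ℤ)) ⊕ (ℕ × (Fin d → ℤ)) → ℝ := Sum.elim (fun _ => p) fun _ => q
  have hpr0 : ∀ c, 0 < pr c := by rintro (c | c) <;> simpa [pr]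
  have hpr1 : ∀ c, pr c ≤ 1 := by rintro (c | c) <;> simp [pr, hp1, hq1.le]
  set E := pairsInto m n A with hE
  have hunion : ∀ s t : Finset (ℕ × (Fin d → ℤ)), s.disjSum t
      = s.map Function.Embedding.inl ∪ t.map Function.Embedding.inr := by
    intro s t
    ext c
    rcases c with c | c <;> simp
  obtain ⟨r, hr⟩ := exists_planarRank m (box d m)
  obtain ⟨r', hr'⟩ := exists_planarRank n (box d n)
  have hEx : ∀ z ∈ E, z.1 ∈ box d m := fun z hz => (mem_pairsInto.1 hz).1.1
  have hEy : ∀ z ∈ E, z.2 ∈ box d n := fun z hz => (mem_pairsInto.1 hz).1.2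
  have hS : hitProb pr ((boxCoins d m).disjSum (boxCoins d n)) (pairPath m n) E
      = hitProb pr ((boxCoins d m).map Function.Embedding.inl
        ∪ (boxCoins d n).map Function.Embedding.inr) (pairPath m n) E := by rw [hunion]
  rw [hS] at hpos ⊢
  obtain ⟨ν, hν0, hν1, hν⟩ := exists_hitProb_mul_hitEnergy_le hpr0 hpr1
    (S₁ := (boxCoins d m).map Function.Embedding.inl)
    (S₂ := (boxCoins d n).map Function.Embedding.inr)
    (by
      rw [Finset.disjoint_left]
      intro c hc hc'
      obtain ⟨a, -, rfl⟩ := Finset.mem_map.1 hc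
      simp at hc')
    (path := pairPath m n) (E := E) (fun z => hunion _ _)
    (fun z hz => Finset.map_subset_map.2 (cellPath_subset_boxCoins (hEx z hz)))
    (fun z hz => Finset.map_subset_map.2 (cellPath_subset_boxCoins (hEy z hz)))
    (hr.map Prod.fst hEx _) (hr'.map Prod.snd hEy _) hpos
  set π := hitProb pr ((boxCoins d m).map Function.Embedding.inl
        ∪ (boxCoins d n).map Function.Embedding.inr) (pairPath m n) E
  have hmaps : ∀ z ∈ E, z.1 + z.2 ∈ A := fun z hz => (mem_pairsInto.1 hz).2
  -- The push-forward of `ν` under addition.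
  set w : (Fin d → ℤ) → ℝ := fun a => ∑ z ∈ E.filter (fun z => z.1 + z.2 = a), ν z with hw
  refine ⟨w, ⟨fun a _ => Finset.sum_nonneg fun z _ => hν0 z, ?_⟩, ?_⟩
  · rw [← hν1]
    exact Finset.sum_fiberwise_of_maps_to hmaps ν
  have hen : energy β A w = ∑ z ∈ E, ∑ z' ∈ E, ν z * ν z' *
      max (dist (toEuc (z.1 + z.2)) (toEuc (z'.1 + z'.2))) 1 ^ (-β) := by
    have h1 : ∀ a a', w a * w a' * max (dist (toEuc a) (toEuc a')) 1 ^ (-β)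
        = ∑ z ∈ E.filter (fun z => z.1 + z.2 = a), ∑ z' ∈ E.filter (fun z => z.1 + z.2 = a'),
          ν z * ν z' * max (dist (toEuc (z.1 + z.2)) (toEuc (z'.1 + z'.2))) 1 ^ (-β) := by
      intro a a'
      simp only [hw]
      rw [Finset.sum_mul_sum, Finset.sum_mul]
      refine Finset.sum_congr rfl fun z hz => ?_
      rw [Finset.sum_mul]
      refine Finset.sum_congr rfl fun z' hz' => ?_
      rw [(Finset.mem_filter.1 hz).2, (Finset.mem_filter.1 hz').2]
    simp only [energy, h1]
    rw [← Finset.sum_fiberwise_of_maps_to hmaps (fun z => ∑ z' ∈ E, ν z * ν z' *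
      max (dist (toEuc (z.1 + z.2)) (toEuc (z'.1 + z'.2))) 1 ^ (-β))]
    refine Finset.sum_congr rfl fun a _ => ?_
    rw [Finset.sum_comm]
    refine Finset.sum_congr rfl fun z _ => ?_
    exact Finset.sum_fiberwise_of_maps_to hmaps _
  set I := (A ×ˢ A).sup fun x => lev (x.2 - x.1) with hI
  set M := max m I with hM
  have hlev : ∀ a ∈ A, ∀ a' ∈ A, lev (a' - a) ≤ M := fun a ha a' ha' =>
    (Finset.le_sup (f := fun x : (Fin d → ℤ) × (Fin d → ℤ) => lev (x.2 - x.1))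
      (Finset.mem_product.2 ⟨ha, ha'⟩ : (a, a') ∈ A ×ˢ A)).trans (le_max_right _ _)
  have hcmp := sum_pow_lev_le_hitEnergy (n := n) hp hp1 hq hq1 hs hm (le_max_left m I) hlev hν0
  have hen2 : energy β A w ≤ 2 ^ β * ∑ z ∈ E, ∑ z' ∈ E,
        ν z * ν z' * (2 ^ d * p * q) ^ lev (z'.1 + z'.2 - (z.1 + z.2)) := by
    rw [hen, Finset.mul_sum]
    refine Finset.sum_le_sum fun z _ => ?_
    rw [Finset.mul_sum]
    refine Finset.sum_le_sum fun z' _ => ?_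
    have := mul_le_mul_of_nonneg_left (rpow_le_pow_lev ht0 hβ hβ0 (z'.1 + z'.2) (z.1 + z.2))
      (mul_nonneg (hν0 z) (hν0 z'))
    rw [dist_comm]
    linarith
  -- Levels exceed the logarithm of the diameter by at most one, which costs one factor `2 ^ d * p`.
  have hsM : (2 ^ d * p) ^ M
      ≤ (2 ^ d * p) * (2 ^ d * p) ^ (max (m : ℝ) (Real.logb 2 (diam A))) := by
    have hs0 : 0 < 2 ^ d * p := by positivity
    rw [← Real.rpow_natCast]
    nth_rewrite 2 [← Real.rpow_one (2 ^ d * p)]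
    rw [← Real.rpow_add hs0]
    refine Real.rpow_le_rpow_of_exponent_le hs.le ?_
    have hm0 : (0 : ℝ) ≤ m := Nat.cast_nonneg m
    have hmax := le_max_left (m : ℝ) (Real.logb 2 (diam A))
    have hall : ∀ x ∈ A ×ˢ A,
        (lev (x.2 - x.1) : ℝ) ≤ 1 + max (m : ℝ) (Real.logb 2 (diam A)) := by
      intro x hx
      rw [Finset.mem_product] at hx
      rcases Nat.eq_zero_or_pos (lev (x.2 - x.1)) with h | h
      · rw [h, Nat.cast_zero]; linarith
      · have := lev_sub_sub_one_le_logb_diam hx.2 hx.1 h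
        have := le_max_right (m : ℝ) (Real.logb 2 (diam A))
        linarith
    rw [hM, Nat.cast_max]
    refine max_le (by linarith) ?_
    rcases (A ×ˢ A).eq_empty_or_nonempty with h | h
    · rw [hI, h, Finset.sup_empty, Nat.bot_eq_zero, Nat.cast_zero]
      linarith
    · obtain ⟨x, hx, he⟩ := Finset.exists_mem_eq_sup _ h fun x => lev (x.2 - x.1)
      rw [hI, he]
      exact hall x hx
  set H := hitEnergy pr (pairPath m n) E ν
  set R := (2 ^ d * p) ^ (max (m : ℝ) (Real.logb 2 (diam A))) with hR
  have hR0 : 0 < R := Real.rpow_pos_of_pos (by positivity) _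
  calc π * energy β A w
      ≤ π * (2 ^ β * (18 ^ d * (1 - q)⁻¹ * (2 ^ d * p) ^ M * q ^ n * H)) :=
        mul_le_mul_of_nonneg_left
          (hen2.trans (mul_le_mul_of_nonneg_left hcmp (by positivity))) hpos.le
    _ = 2 ^ β * (18 ^ d * (1 - q)⁻¹) * (2 ^ d * p) ^ M * q ^ n * (π * H) := by ring
    _ ≤ 2 ^ β * (18 ^ d * (1 - q)⁻¹) * (2 ^ d * p) ^ M * q ^ n * 256 :=
        mul_le_mul_of_nonneg_left hν (by positivity)
    _ ≤ 2 ^ β * (18 ^ d * (1 - q)⁻¹) * ((2 ^ d * p) * R) * q ^ n * 256 := by gcongr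
    _ = _ := by ring

end UpperBound

end FractalPercolation

end

/-- For a singleton `Real.logb 2 0 = 0` replaces the convention `-∞`; this is harmless because the
maximum is taken with `m ≥ 1`. -/
theorem theorem2 (d : ℕ) (hd : 1 ≤ d) (p q β : ℝ)
    (hp : p ∈ Set.Ioo (0 : ℝ) 1) (hq : q ∈ Set.Ioo (0 : ℝ) 1)
    (hβ : β = -Real.logb 2 (2 ^ d * p * q)) (hβ_pos : 0 < β)
    (hp' : ((2 : ℝ) ^ d)⁻¹ < p) (hq' : ((2 : ℝ) ^ d)⁻¹ < q) :
    ∃ c C : ℝ, 0 < c ∧ 0 < C ∧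
      ∀ (Ω : Type*) [MeasurableSpace Ω] (P : Measure Ω) [IsProbabilityMeasure P]
        (ξ η : ℕ × (Fin d → ℤ) → Ω → Bool),
        FractalPercolation.IsCoinField p P ξ →
        FractalPercolation.IsCoinField q P η →
        IndepFun (fun ω c => ξ c ω) (fun ω c => η c ω) P →
        ∀ (m n : ℕ), 1 ≤ m → m ≤ n →
        ∀ A : Finset (Fin d → ℤ), A.Nonempty →
          (∀ a ∈ A, ∀ i, -(2 : ℤ) ^ (n - 1) ≤ a i ∧ a i < (2 : ℤ) ^ (n - 1)) →
          c * (2 ^ d * p) ^ m ≤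
              P.real {ω | ((FractalPercolation.discretePerc ξ m ω
                  + FractalPercolation.discretePerc η n ω) ∩ (A : Set (Fin d → ℤ))).Nonempty}
                / (q ^ n * FractalPercolation.cap β A) ∧
            P.real {ω | ((FractalPercolation.discretePerc ξ m ω
                  + FractalPercolation.discretePerc η n ω) ∩ (A : Set (Fin d → ℤ))).Nonempty}
                / (q ^ n * FractalPercolation.cap β A)
              ≤ C * (2 ^ d * p) ^ (max (m : ℝ) (Real.logb 2 (FractalPercolation.diam A))) := by
  open FractalPercolation in
  have h2d : (0 : ℝ) < 2 ^ d := by positivity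
  have hs : 1 < 2 ^ d * p := by rwa [inv_lt_iff_one_lt_mul₀' h2d] at hp'
  have hs' : 1 < 2 ^ d * q := by rwa [inv_lt_iff_one_lt_mul₀' h2d] at hq'
  have ht0 : 0 < 2 ^ d * p * q := mul_pos (by linarith) hq.1
  have ht : 2 ^ d * p * q < 1 := by
    rw [← Real.logb_neg_iff (by norm_num : (1 : ℝ) < 2) ht0]
    linarith
  obtain ⟨c, hc, hlow⟩ := exists_le_hitProb_mul_energy hd hp.1 hp.2.le hq.1 hq.2.le hs hs' ht
    hβ hβ_pos
  obtain ⟨C, hC, hup⟩ := exists_hitProb_mul_energy_le (d := d) hp.1 hp.2.le hq.1 hq.2 hs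
    hβ hβ_pos
  refine ⟨c, C, hc, hC, fun Ω _ P _ ξ η hξ hη hind m n hm hmn A hA hAn => ?_⟩
  have hAbox : A ⊆ box d n := fun a ha => mem_box.2 (hAn a ha)
  have hprob := measureReal_hit_eq_hitProb hp.1.le hq.1.le hξ hη hind hm (hm.trans hmn) A
  have hlow' := hlow m n hm hmn A hAbox
  have hup' := hup m n hm A
  rw [← hprob] at hlow' hup'
  set π := P.real {ω | ((discretePerc ξ m ω + discretePerc η n ω)
    ∩ (A : Set (Fin d → ℤ))).Nonempty}
  have hπ0 : 0 ≤ π := measureReal_nonneg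
  have hpm : 0 < c * (2 ^ d * p) ^ m * q ^ n :=
    mul_pos (mul_pos hc (pow_pos (by linarith) m)) (pow_pos hq.1 n)
  obtain ⟨a, ha⟩ := hA
  have hdirac : (fun x => if x = a then (1 : ℝ) else 0) ∈ probWeights A := by
    refine ⟨fun x _ => by dsimp only; split_ifs <;> norm_num, ?_⟩
    rw [Finset.sum_ite_eq', if_pos ha]
  -- The lower estimate applied to a Dirac mass excludes a zero hitting probability, which the upper
  -- estimate needs.
  have hπ : 0 < π := by
    refine hπ0.lt_of_ne fun h => ?_
    have := hlow' _ hdirac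
    rw [← h, zero_mul] at this
    linarith
  set I := sInf (energy β A '' probWeights A) with hI
  have hlb : ∀ e ∈ energy β A '' probWeights A, c * (2 ^ d * p) ^ m * q ^ n / π ≤ e := by
    rintro _ ⟨w, hw, rfl⟩
    rw [div_le_iff₀' hπ]
    exact hlow' w hw
  have hI1 : c * (2 ^ d * p) ^ m * q ^ n / π ≤ I :=
    le_csInf ⟨_, Set.mem_image_of_mem _ hdirac⟩ hlb
  have hI2 : ∀ w ∈ probWeights A, I ≤ energy β A w := fun w hw =>
    csInf_le ⟨_, hlb⟩ (Set.mem_image_of_mem _ hw)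
  have hqn : 0 < q ^ n := pow_pos hq.1 n
  -- Dividing by the capacity is multiplying by the infimal energy, so both bounds concern `π * I`.
  have hcap : π / (q ^ n * cap β A) = π * I / q ^ n := by
    rw [cap, ← hI, ← div_div, div_inv_eq_mul, div_mul_eq_mul_div]
  rw [hcap, le_div_iff₀ hqn, div_le_iff₀ hqn]
  constructor
  · rwa [div_le_iff₀' hπ] at hI1
  · obtain ⟨w, hw, h⟩ := hup' hπ
    exact (mul_le_mul_of_nonneg_left (hI2 w hw) hπ0).trans h
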